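/- Let $r\ge 1$ and $n\ge 2$ be integers, let $q$ be an indeterminate and $\mathcal R=\mathbb Z[\tfrac1r][q,q^{-1}]$. Indices $i$ of $s_i$, $T_{s_i}$, $e_i$ and $j$ of $t_j$ are read modulo $n$ (so $t_0=t_n$). Let $\widehat W$ (the extended affine Weyl group of type $A$) be the group generated by $\rho,s_0,\dots,s_{n-1}$ with relations $$s_i^2=1,\qquad s_is_j=s_js_i\ \text{ if } i-j\not\equiv\pm1 \pmod n,\qquad \rho s_i=s_{i-1}\rho,\qquad s_is_{i+1}s_i=s_{i+1}s_is_{i+1}\ \text{ if } n\ge 3 .$$ Let $\widehat W_{r,n}$ be the group generated by $t_1,\dots,t_n,\rho,s_0,\dots,s_{n-1}$ with the same relations together with $$t_j^r=1,\qquad t_it_j=t_jt_i,\qquad s_it_j=t_{s_i(j)}s_i\ \ (1\le i\le n-1),\qquad \rho t_j=t_{j-1}\rho ,$$ where $s_i(j)$ is the image of $j$ under the transposition $(i,i+1)$. There is a canonical homomorphism $\widehat W\to\widehat W_{r,n}$ with $s_i\mapsto s_i$, $\rho\mapsto\rho$. For a word $s_{i_1}\cdots s_{i_m}$, the expression $t_1^{\beta_1}\cdots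 t_n^{\beta_n}\rho^k s_{i_1}\cdots s_{i_m}$ (with $0\le\beta_j\le r-1$, $k\in\mathbb Z$) of an element of $\widehat W_{r,n}$ is called reduced if $s_{i_1}\cdots s_{i_m}$ is a reduced word in the affine Weyl group $W^{\mathrm{aff}}=\langle s_0,\dots,s_{n-1}\rangle\subset\widehat W$, i.e. no product of fewer than $m$ of the $s_i$ equals it in $\widehat W$. Let $\widehat H^{\mathrm{aff}}_{r,n}$ be the associative unital $\mathcal R$-algebra generated by $t_1,\dots,t_n,T_{s_0},\dots,T_{s_{n-1}},T_\rho^{\pm1}$ with relations $$t_j^r=1,\quad t_it_j=t_jt_i,\quad T_{s_i}t_j=t_{s_i(j)}T_{s_i}\ (1\le i\le n-1),\quad T_\rho t_j=t_{j-1}T_\rho,\quad T_\rho T_{s_i}=T_{s_{i-1}}T_\rho,\quad T_\rho T_\rho^{-1}=T_\rho^{-1}T_\rho=1,$$ $$T_{s_i}T_{s_j}=T_{s_j}T_{s_i}\ \text{ if } i-j\not\equiv\pm1\pmod n,\qquad T_{s_i}T_{s_{i+1}}T_{s_i}=T_{s_{i+1}}T_{s_i}T_{s_{i+1}}\ \text{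 if } n\ge3,$$ $$T_{s_i}^2=1+(q-q^{-1})e_iT_{s_i},\qquad e_i=\frac1r\sum_{a=0}^{r-1}t_i^a t_{i+1}^{-a}\qquad(0\le i\le n-1).$$ For $w\in\widehat W_{r,n}$ with reduced expression $w=t_1^{\beta_1}\cdots t_n^{\beta_n}\rho^k s_{i_1}\cdots s_{i_m}$ put $T_w:=t_1^{\beta_1}\cdots t_n^{\beta_n}\,T_\rho^k\,T_{s_{i_1}}\cdots T_{s_{i_m}}$. Then $T_w$ does not depend on the choice of the reduced expression, and $\widehat H^{\mathrm{aff}}_{r,n}$ is a free $\mathcal R$-module with basis $\{T_w : w\in\widehat W_{r,n}\}$. The elements $t_1^{\beta_1}\cdots t_n^{\beta_n}T_{\widehat w}$ with $0\le\beta_1,\dots,\beta_n\le r-1$ and $\widehat w\in\widehat W$ (where $T_{\widehat w}$ is formed with the image of $\widehat w$ in $\widehat W_{r,n}$), indexed by the pairs $(\beta,\widehat w)$, are likewise an $\mathcal R$-basis. -/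

import Mathlib

namespace AffineYokonuma

/-! Indices of the generators `t_j` (`1 ≤ j ≤ n`, with `t_0 = t_n`) and `s_i` (`0 ≤ i ≤ n - 1`) are
taken in `ZMod n`; the transposition `s_i = (i, i+1)` is `Equiv.swap i (i + 1)` on `ZMod n`. -/

/-! ### The extended affine Weyl group of type A -/

/-- Generators `s_i`, `ρ`. -/
inductive ExtGen (n : ℕ) : Type
  | s (i : ZMod n)
  | rho

/-- Defining relations `x = y` of the extended affine Weyl group. -/
inductive ExtRel (n : ℕ) : FreeGroup (ExtGen n) → FreeGroup (ExtGen n) → Prop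
  | s_sq (i : ZMod n) :
      ExtRel n (FreeGroup.of (.s i) ^ 2) 1
  | s_comm (i j : ZMod n) (h₁ : i - j ≠ 1) (h₂ : i - j ≠ -1) :
      ExtRel n (FreeGroup.of (.s i) * FreeGroup.of (.s j))
        (FreeGroup.of (.s j) * FreeGroup.of (.s i))
  | rho_s (i : ZMod n) :
      ExtRel n (FreeGroup.of .rho * FreeGroup.of (.s i))
        (FreeGroup.of (.s (i - 1)) * FreeGroup.of .rho)
  | braid (hn : 3 ≤ n) (i : ZMod n) :
      ExtRel n (FreeGroup.of (.s i) * FreeGroup.of (.s (i + 1)) * FreeGroup.of (.s i))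
        (FreeGroup.of (.s (i + 1)) * FreeGroup.of (.s i) * FreeGroup.of (.s (i + 1)))

/-- The extended affine Weyl group of type A, given by generators and relations. -/
abbrev ExtAffWeyl (n : ℕ) : Type :=
  PresentedGroup {x : FreeGroup (ExtGen n) | ∃ a b, ExtRel n a b ∧ x = a * b⁻¹}

/-- The product `s_{i_1} ⋯ s_{i_m}` in the extended affine Weyl group. -/
def ExtAffWeyl.sWord {n : ℕ} (l : List (ZMod n)) : ExtAffWeyl n :=
  (l.map fun i => PresentedGroup.of (ExtGen.s i)).prod

/-- The Coxeter length on the affine Weyl group, the subgroup generated by the `s_i`: the least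
number of factors in an expression of `w` as a product of the `s_i`. -/
noncomputable def ExtAffWeyl.affLength {n : ℕ} (w : ExtAffWeyl n) : ℕ :=
  sInf {m | ∃ l : List (ZMod n), l.length = m ∧ ExtAffWeyl.sWord l = w}

/-! ### The group `Ŵ_{r,n}` -/

/-- Generators `t_j`, `s_i`, `ρ`. -/
inductive YGen (n : ℕ) : Type
  | t (j : ZMod n)
  | s (i : ZMod n)
  | rho

/-- Defining relations `x = y` of the group `Ŵ_{r,n}`. -/
inductive YRel (r n : ℕ) : FreeGroup (YGen n) → FreeGroup (YGen n) → Prop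
  | s_sq (i : ZMod n) :
      YRel r n (FreeGroup.of (.s i) ^ 2) 1
  | s_comm (i j : ZMod n) (h₁ : i - j ≠ 1) (h₂ : i - j ≠ -1) :
      YRel r n (FreeGroup.of (.s i) * FreeGroup.of (.s j))
        (FreeGroup.of (.s j) * FreeGroup.of (.s i))
  | rho_s (i : ZMod n) :
      YRel r n (FreeGroup.of .rho * FreeGroup.of (.s i))
        (FreeGroup.of (.s (i - 1)) * FreeGroup.of .rho)
  | braid (hn : 3 ≤ n) (i : ZMod n) :
      YRel r n (FreeGroup.of (.s i) * FreeGroup.of (.s (i + 1)) * FreeGroup.of (.s i))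
        (FreeGroup.of (.s (i + 1)) * FreeGroup.of (.s i) * FreeGroup.of (.s (i + 1)))
  | t_pow (j : ZMod n) :
      YRel r n (FreeGroup.of (.t j) ^ r) 1
  | t_comm (i j : ZMod n) :
      YRel r n (FreeGroup.of (.t i) * FreeGroup.of (.t j))
        (FreeGroup.of (.t j) * FreeGroup.of (.t i))
  | s_t (i j : ZMod n) (hi : i ≠ 0) :
      YRel r n (FreeGroup.of (.s i) * FreeGroup.of (.t j))
        (FreeGroup.of (.t (Equiv.swap i (i + 1) j)) * FreeGroup.of (.s i))
  | rho_t (j : ZMod n) :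
      YRel r n (FreeGroup.of .rho * FreeGroup.of (.t j))
        (FreeGroup.of (.t (j - 1)) * FreeGroup.of .rho)

/-- The group `Ŵ_{r,n}`, given by generators and relations. -/
abbrev YWeyl (r n : ℕ) : Type :=
  PresentedGroup {x : FreeGroup (YGen n) | ∃ a b, YRel r n a b ∧ x = a * b⁻¹}

namespace YWeyl

variable {r n : ℕ}

def t (j : ZMod n) : YWeyl r n := PresentedGroup.of (YGen.t j)

def s (i : ZMod n) : YWeyl r n := PresentedGroup.of (YGen.s i)

def rho : YWeyl r n := PresentedGroup.of YGen.rho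

theorem eq_of_rel {a b : FreeGroup (YGen n)} (h : YRel r n a b) :
    (PresentedGroup.mk {x | ∃ a b, YRel r n a b ∧ x = a * b⁻¹} a) =
      PresentedGroup.mk {x | ∃ a b, YRel r n a b ∧ x = a * b⁻¹} b := by
  have h1 : PresentedGroup.mk {x | ∃ a b, YRel r n a b ∧ x = a * b⁻¹} (a * b⁻¹) = 1 :=
    PresentedGroup.one_of_mem ⟨a, b, h, rfl⟩
  rw [map_mul, map_inv] at h1
  exact mul_inv_eq_one.mp h1

/-- Images of the generators `s_i`, `ρ` of the extended affine Weyl group in `Ŵ_{r,n}`. -/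
def ofExtGen : ExtGen n → YWeyl r n
  | .s i => s i
  | .rho => rho

/-- The canonical homomorphism `Ŵ → Ŵ_{r,n}`, with `s_i ↦ s_i` and `ρ ↦ ρ`. -/
def ofExt : ExtAffWeyl n →* YWeyl r n :=
  PresentedGroup.toGroup (f := ofExtGen) (by
    rintro x ⟨a, b, h, rfl⟩
    rw [map_mul, map_inv, mul_inv_eq_one]
    cases h with
    | s_sq i => simpa [ofExtGen, s, rho, PresentedGroup.of] using eq_of_rel (YRel.s_sq (r := r) i)
    | s_comm i j h₁ h₂ => simpa [ofExtGen, s, rho, PresentedGroup.of] using eq_of_rel (YRel.s_comm (r := r) i j h₁ h₂)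
    | rho_s i => simpa [ofExtGen, s, rho, PresentedGroup.of] using eq_of_rel (YRel.rho_s (r := r) i)
    | braid hn i => simpa [ofExtGen, s, rho, PresentedGroup.of] using eq_of_rel (YRel.braid (r := r) hn i))

/-- `t_1^{β_1} ⋯ t_n^{β_n}`, with `0 ≤ β_j ≤ r - 1`. -/
def tPow (β : Fin n → Fin r) : YWeyl r n :=
  (List.ofFn fun j : Fin n => t (((j : ℕ) + 1 : ℕ) : ZMod n) ^ (β j : ℕ)).prod

/-- `w = t^β ρ^k s_{i_1} ⋯ s_{i_m}` with `m` equal to the length of `w`, where the length is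
extended from the affine Weyl group by `ℓ(t^β ρ^k w') = ℓ(w')`. -/
def IsReducedExpr (w : YWeyl r n) (β : Fin n → Fin r) (k : ℤ) (l : List (ZMod n)) : Prop :=
  w = tPow β * rho ^ k * (l.map s).prod ∧
    l.length = ExtAffWeyl.affLength (ExtAffWeyl.sWord l)

end YWeyl

/-! ### The algebra -/

/-- `ℤ[1/r]`. -/
def IntInv (r : ℕ) : Type := Localization.Away (r : ℤ)

noncomputable instance (r : ℕ) : CommRing (IntInv r) :=
  inferInstanceAs (CommRing (Localization.Away (r : ℤ)))

instance (r : ℕ) : IsLocalization.Away (r : ℤ) (IntInv r) := by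
  have key : ∀ A : Algebra ℤ (Localization.Away (r : ℤ)),
      @IsLocalization.Away ℤ _ (r : ℤ) (Localization.Away (r : ℤ)) _ A := by
    intro A
    rw [Subsingleton.elim A OreLocalization.instAlgebra]
    infer_instance
  exact key _

/-- `ℤ[1/r][q, q⁻¹]`. -/
abbrev BaseRing (r : ℕ) : Type := LaurentPolynomial (IntInv r)

/-- The element `q - q⁻¹`. -/
noncomputable def qDiff (r : ℕ) : BaseRing r := LaurentPolynomial.T 1 - LaurentPolynomial.T (-1)

/-- The element `1 / r`. -/
noncomputable def rInv (r : ℕ) : BaseRing r :=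
  LaurentPolynomial.C (IsLocalization.Away.invSelf (r : ℤ))

/-- Generators `t_j`, `T_{s_i}`, `T_ρ`, `T_ρ⁻¹`. -/
inductive HGen (n : ℕ) : Type
  | t (j : ZMod n)
  | s (i : ZMod n)
  | rho
  | rhoInv

/-- A generator in the free algebra. -/
noncomputable def gen (r : ℕ) {n : ℕ} (x : HGen n) : FreeAlgebra (BaseRing r) (HGen n) :=
  FreeAlgebra.ι (BaseRing r) x

/-- `e_i = (1/r) ∑_{0 ≤ a ≤ r-1} t_i^a t_{i+1}^{-a}`. As `t_{i+1}^r = 1` is imposed, `t_{i+1}^{-a}`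
is written `t_{i+1}^{r-a}`. -/
noncomputable def idem (r : ℕ) {n : ℕ} (i : ZMod n) : FreeAlgebra (BaseRing r) (HGen n) :=
  rInv r • ∑ a ∈ Finset.range r, gen r (.t i) ^ a * gen r (.t (i + 1)) ^ (r - a)

/-- Defining relations of the algebra `Ĥ^aff_{r,n}`. -/
inductive HRel (r n : ℕ) :
    FreeAlgebra (BaseRing r) (HGen n) → FreeAlgebra (BaseRing r) (HGen n) → Prop
  | t_pow (j : ZMod n) :
      HRel r n (gen r (.t j) ^ r) 1
  | t_comm (i j : ZMod n) :
      HRel r n (gen r (.t i) * gen r (.t j)) (gen r (.t j) * gen r (.t i))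
  | s_t (i j : ZMod n) (hi : i ≠ 0) :
      HRel r n (gen r (.s i) * gen r (.t j)) (gen r (.t (Equiv.swap i (i + 1) j)) * gen r (.s i))
  | rho_t (j : ZMod n) :
      HRel r n (gen r .rho * gen r (.t j)) (gen r (.t (j - 1)) * gen r .rho)
  | rho_s (i : ZMod n) :
      HRel r n (gen r .rho * gen r (.s i)) (gen r (.s (i - 1)) * gen r .rho)
  | s_comm (i j : ZMod n) (h₁ : i - j ≠ 1) (h₂ : i - j ≠ -1) :
      HRel r n (gen r (.s i) * gen r (.s j)) (gen r (.s j) * gen r (.s i))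
  | braid (hn : 3 ≤ n) (i : ZMod n) :
      HRel r n (gen r (.s i) * gen r (.s (i + 1)) * gen r (.s i))
        (gen r (.s (i + 1)) * gen r (.s i) * gen r (.s (i + 1)))
  | quad (i : ZMod n) :
      HRel r n (gen r (.s i) ^ 2) (1 + qDiff r • (idem r i * gen r (.s i)))
  | rho_rhoInv :
      HRel r n (gen r .rho * gen r .rhoInv) 1
  | rhoInv_rho :
      HRel r n (gen r .rhoInv * gen r .rho) 1

/-- The algebra `Ĥ^aff_{r,n}` over `ℤ[1/r][q, q⁻¹]`. -/
def HAff (r n : ℕ) : Type := RingQuot (HRel r n)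

noncomputable instance (r n : ℕ) : Semiring (HAff r n) := RingQuot.instSemiring (HRel r n)

noncomputable instance (r n : ℕ) : Algebra (BaseRing r) (HAff r n) :=
  RingQuot.instAlgebra (HRel r n)

namespace HAff

variable {r n : ℕ}

/-- The quotient map from the free algebra. -/
noncomputable def mk (r n : ℕ) : FreeAlgebra (BaseRing r) (HGen n) →ₐ[BaseRing r] HAff r n :=
  RingQuot.mkAlgHom (BaseRing r) (HRel r n)

theorem mk_eq_of_rel {x y : FreeAlgebra (BaseRing r) (HGen n)} (h : HRel r n x y) :
    mk r n x = mk r n y :=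
  RingQuot.mkAlgHom_rel (BaseRing r) h

noncomputable def t (j : ZMod n) : HAff r n := mk r n (gen r (.t j))

noncomputable def Ts (i : ZMod n) : HAff r n := mk r n (gen r (.s i))

/-- `T_ρ`, as an invertible element with inverse `T_ρ⁻¹`. -/
noncomputable def Trho : (HAff r n)ˣ where
  val := mk r n (gen r .rho)
  inv := mk r n (gen r .rhoInv)
  val_inv := by rw [← map_mul, mk_eq_of_rel HRel.rho_rhoInv, map_one]
  inv_val := by rw [← map_mul, mk_eq_of_rel HRel.rhoInv_rho, map_one]

/-- `t_1^{β_1} ⋯ t_n^{β_n}`, with `0 ≤ β_j ≤ r - 1`. -/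
noncomputable def tPow (β : Fin n → Fin r) : HAff r n :=
  (List.ofFn fun j : Fin n => t (((j : ℕ) + 1 : ℕ) : ZMod n) ^ (β j : ℕ)).prod

/-- `t^β T_ρ^k T_{s_{i_1}} ⋯ T_{s_{i_m}}`. -/
noncomputable def ofExpr (β : Fin n → Fin r) (k : ℤ) (l : List (ZMod n)) : HAff r n :=
  tPow β * ((Trho ^ k : (HAff r n)ˣ) : HAff r n) * (l.map Ts).prod

open Classical in
/-- `T_w`: the product `t^β T_ρ^k T_{s_{i_1}} ⋯ T_{s_{i_m}}` for some chosen reduced expression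
`t^β ρ^k s_{i_1} ⋯ s_{i_m}` of `w`. -/
noncomputable def T (w : YWeyl r n) : HAff r n :=
  if h : ∃ e : (Fin n → Fin r) × ℤ × List (ZMod n), YWeyl.IsReducedExpr w e.1 e.2.1 e.2.2 then
    ofExpr h.choose.1 h.choose.2.1 h.choose.2.2
  else 0

end HAff

end AffineYokonuma

/-! Spanning is a rewriting argument; the substance is linear independence, which comes from a
representation. On the free module with basis `ExtAffWeyl n` over the group algebra of the torus,
the generators are made to act by the formulas that left multiplication on the elements `a T_w` must
obey (`leftOp`, `leftMul`). Once the defining relations hold for these operators (`genAction_rel`),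
applying an algebra element to the basis vector at `1` inverts the map sending the formal `a T_w` to
the actual one (`action_fromStd`, `fromStd_action`).

The quadratic relation is a direct computation. The commutation and braid relations are not checked
on every basis vector: left operators commute with right multiplication operators
(`leftOp_rightOp`), and semilinear operators with this property are determined by their value at `1`
(`eq_of_commute_right`), where no descents occur and both sides give the same group element. Two
properties of the parameters `(q - q⁻¹) e_i` are needed: if `s_i w = w s_j` then `w` carries `e_j`
to `e_i`, and `e_i t_i = e_i t_{i+1}`.

The combinatorial input is derived from the presentation. An action on signed group elements gives
the cocycle `inversion`, hence descents and the strong exchange property (`exists_eraseIdx`).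
Exchange yields the word property `IsReduced.prod_map_eq`, so `T_w` is independent of the reduced
word.

Finally, a map to the semidirect product of the torus and the extended affine Weyl group shows that
`t^β w` is a unique normal form in `YWeyl r n`, so both families in the theorem are the same basis
with different indexing. -/

namespace AffineYokonuma

/-! ### Consequences of the presentation of the extended affine Weyl group -/

namespace ExtAffWeyl

variable {n : ℕ}

/-- The generator `s_i` of the extended affine Weyl group. -/
def s (i : ZMod n) : ExtAffWeyl n := PresentedGroup.of (ExtGen.s i)

/-- The generator `ρ` of the extended affine Weyl group. -/
def rho : ExtAffWeyl n := PresentedGroup.of ExtGen.rho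

theorem eq_of_rel {a b : FreeGroup (ExtGen n)} (h : ExtRel n a b) :
    (PresentedGroup.mk {x | ∃ a b, ExtRel n a b ∧ x = a * b⁻¹} a) =
      PresentedGroup.mk {x | ∃ a b, ExtRel n a b ∧ x = a * b⁻¹} b := by
  have h1 : PresentedGroup.mk {x | ∃ a b, ExtRel n a b ∧ x = a * b⁻¹} (a * b⁻¹) = 1 :=
    PresentedGroup.one_of_mem ⟨a, b, h, rfl⟩
  rw [map_mul, map_inv] at h1
  exact mul_inv_eq_one.mp h1

@[simp] theorem s_mul_self (i : ZMod n) : s i * s i = 1 := by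
  have := eq_of_rel (ExtRel.s_sq i)
  rwa [pow_two, map_mul, map_one] at this

@[simp] theorem s_mul_s_mul (i : ZMod n) (w : ExtAffWeyl n) : s i * (s i * w) = w := by
  rw [← mul_assoc, s_mul_self, one_mul]

@[simp] theorem mul_s_mul_s (i : ZMod n) (w : ExtAffWeyl n) : w * s i * s i = w := by
  rw [mul_assoc, s_mul_self, mul_one]

@[simp] theorem s_inv (i : ZMod n) : (s i)⁻¹ = s i := inv_eq_of_mul_eq_one_left (s_mul_self i)

theorem s_comm (i j : ZMod n) (h₁ : i - j ≠ 1) (h₂ : i - j ≠ -1) : s i * s j = s j * s i := by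
  have := eq_of_rel (ExtRel.s_comm i j h₁ h₂)
  rwa [map_mul, map_mul] at this

theorem rho_mul_s (i : ZMod n) : rho * s i = s (i - 1) * rho := by
  have := eq_of_rel (ExtRel.rho_s i)
  rwa [map_mul, map_mul] at this

theorem braid (hn : 3 ≤ n) (i : ZMod n) : s i * s (i + 1) * s i = s (i + 1) * s i * s (i + 1) := by
  have := eq_of_rel (ExtRel.braid hn i)
  rwa [map_mul, map_mul, map_mul, map_mul] at this

theorem s_mul_rho_zpow (i : ZMod n) (k : ℤ) : s i * rho ^ k = rho ^ k * s (i + (k : ZMod n)) := by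
  induction k using Int.induction_on with
  | zero => simp
  | succ k ih =>
    have h := rho_mul_s (i + ((k : ℤ) : ZMod n) + 1)
    rw [add_sub_cancel_right] at h
    rw [zpow_add_one, ← mul_assoc, ih, mul_assoc, ← h, ← mul_assoc]
    push_cast
    rw [add_assoc]
  | pred k ih =>
    have h := rho_mul_s (i + ((-k : ℤ) : ZMod n))
    have h' : s (i + ((-k : ℤ) : ZMod n)) * rho⁻¹ = rho⁻¹ * s (i + ((-k : ℤ) : ZMod n) - 1) := by
      rw [mul_inv_eq_iff_eq_mul, mul_assoc, ← h, inv_mul_cancel_left]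
    rw [zpow_sub_one, ← mul_assoc, ih, mul_assoc, h', ← mul_assoc]
    push_cast
    rw [add_sub_assoc]

/-- The homomorphism out of the extended affine Weyl group given by images of the generators. -/
def lift {K : Type*} [Group K] (f : ZMod n → K) (p : K) (hsq : ∀ i, f i * f i = 1)
    (hcomm : ∀ i j, i - j ≠ 1 → i - j ≠ -1 → f i * f j = f j * f i)
    (hrho : ∀ i, p * f i = f (i - 1) * p)
    (hbraid : 3 ≤ n → ∀ i, f i * f (i + 1) * f i = f (i + 1) * f i * f (i + 1)) :
    ExtAffWeyl n →* K :=
  PresentedGroup.toGroup (f := fun x => match x with | .s i => f i | .rho => p) (by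
    rintro x ⟨a, b, h, rfl⟩
    rw [map_mul, map_inv, mul_inv_eq_one]
    cases h with
    | s_sq i => simpa [pow_two] using hsq i
    | s_comm i j h₁ h₂ => simpa using hcomm i j h₁ h₂
    | rho_s i => simpa using hrho i
    | braid hn i => simpa using hbraid hn i)

section lift

variable {K : Type*} [Group K] {f : ZMod n → K} {p : K} {hsq : ∀ i, f i * f i = 1}
  {hcomm : ∀ i j, i - j ≠ 1 → i - j ≠ -1 → f i * f j = f j * f i}
  {hrho : ∀ i, p * f i = f (i - 1) * p}
  {hbraid : 3 ≤ n → ∀ i, f i * f (i + 1) * f i = f (i + 1) * f i * f (i + 1)}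

@[simp] theorem lift_s (i : ZMod n) : lift f p hsq hcomm hrho hbraid (s i) = f i :=
  PresentedGroup.toGroup.of _

@[simp] theorem lift_rho : lift f p hsq hcomm hrho hbraid rho = p :=
  PresentedGroup.toGroup.of _

end lift

theorem closure_gens : Subgroup.closure (Set.range (s (n := n)) ∪ {rho}) = ⊤ := by
  rw [← PresentedGroup.closure_range_of]
  congr 1
  ext x
  constructor
  · rintro (⟨i, rfl⟩ | rfl)
    exacts [⟨_, rfl⟩, ⟨_, rfl⟩]
  · rintro ⟨i | _, rfl⟩
    exacts [Or.inl ⟨i, rfl⟩, Or.inr rfl]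

theorem induction_left {P : ExtAffWeyl n → Prop} (one : P 1) (hs : ∀ i w, P w → P (s i * w))
    (hr : ∀ w, P w → P (rho * w)) (hr' : ∀ w, P w → P (rho⁻¹ * w)) (w : ExtAffWeyl n) : P w := by
  have hw : w ∈ Subgroup.closure (Set.range (s (n := n)) ∪ {rho}) := closure_gens ▸ trivial
  induction hw using Subgroup.closure_induction_left with
  | one => exact one
  | mul_left x hx y _ ih =>
    rcases hx with ⟨i, rfl⟩ | rfl
    exacts [hs _ _ ih, hr _ ih]
  | inv_mul_cancel x hx y _ ih =>
    rcases hx with ⟨i, rfl⟩ | rfl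
    exacts [by rw [s_inv]; exact hs _ _ ih, hr' _ ih]

theorem induction_right {P : ExtAffWeyl n → Prop} (one : P 1) (hs : ∀ i w, P w → P (w * s i))
    (hr : ∀ w, P w → P (w * rho)) (hr' : ∀ w, P w → P (w * rho⁻¹)) (w : ExtAffWeyl n) : P w := by
  have key : ∀ w : ExtAffWeyl n, P w⁻¹ := by
    intro w
    induction w using induction_left with
    | one => simpa
    | hs i w ih => simpa using hs i _ ih
    | hr w ih => simpa using hr' _ ih
    | hr' w ih => simpa using hr _ ih
  simpa using key w⁻¹

/-- Every element of the extended affine Weyl group is `ρ^k s_{i_1} ⋯ s_{i_m}`. -/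
theorem exists_eq_rho_zpow_mul_sWord (w : ExtAffWeyl n) :
    ∃ (k : ℤ) (l : List (ZMod n)), w = rho ^ k * sWord l := by
  induction w using induction_left with
  | one => exact ⟨0, [], by simp [sWord]⟩
  | hs i w ih =>
    obtain ⟨k, l, rfl⟩ := ih
    refine ⟨k, (i + (k : ZMod n)) :: l, ?_⟩
    rw [← mul_assoc, s_mul_rho_zpow, mul_assoc]
    simp [sWord, s]
  | hr w ih =>
    obtain ⟨k, l, rfl⟩ := ih
    exact ⟨1 + k, l, by rw [zpow_one_add, mul_assoc]⟩
  | hr' w ih =>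
    obtain ⟨k, l, rfl⟩ := ih
    exact ⟨-1 + k, l, by rw [zpow_add, mul_assoc, zpow_neg_one]⟩

@[simp] theorem sWord_nil : sWord ([] : List (ZMod n)) = 1 := rfl

@[simp] theorem sWord_cons (i : ZMod n) (l : List (ZMod n)) : sWord (i :: l) = s i * sWord l := by
  simp [sWord, s]

/-- The exponent of `ρ`. -/
def rhoDegree : ExtAffWeyl n →* Multiplicative ℤ :=
  lift (fun _ => 1) (Multiplicative.ofAdd 1) (by simp) (by simp) (by simp) (by simp)

@[simp] theorem rhoDegree_sWord (l : List (ZMod n)) : rhoDegree (sWord l) = 1 := by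
  induction l with
  | nil => simp
  | cons i l ih =>
    rw [sWord_cons, map_mul, ih, mul_one]
    simp [rhoDegree]

/-- The degree in `ρ` is a homomorphism that vanishes on every `s_i`, so it recovers the exponent;
the rest is cancellation. -/
theorem rho_zpow_mul_sWord_inj {k k' : ℤ} {l l' : List (ZMod n)}
    (h : (rho ^ k * sWord l : ExtAffWeyl n) = rho ^ k' * sWord l') :
    k = k' ∧ sWord l = sWord l' := by
  have h1 := congrArg rhoDegree h
  simp only [map_mul, rhoDegree_sWord, map_zpow, mul_one] at h1
  simp only [rhoDegree, lift_rho, ← ofAdd_zsmul, smul_eq_mul, mul_one] at h1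
  obtain rfl := Multiplicative.ofAdd.injective h1
  exact ⟨rfl, mul_left_cancel h⟩

/-! ### Inversions -/

/-- The action of a generator `s_i` on signed elements: conjugation by `s_i`, with a change of
sign at `s_i`. -/
noncomputable def signedConj (i : ZMod n) : Equiv.Perm (ExtAffWeyl n × ZMod 2) := by
  classical
  exact Function.Involutive.toPerm
    (fun p => (s i * p.1 * s i, p.2 + if p.1 = s i then 1 else 0)) (by
      intro p
      have : s i * p.1 * s i = s i ↔ p.1 = s i := by
        constructor
        · intro h
          simpa [mul_assoc] using congrArg (fun x => s i * x * s i) h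
        · intro h
          simp [h]
      ext
      · simp [mul_assoc]
      · simp only [this]
        rw [add_assoc, CharTwo.add_self_eq_zero, add_zero])

open Classical in
theorem signedConj_apply (i : ZMod n) (p : ExtAffWeyl n × ZMod 2) :
    signedConj i p = (s i * p.1 * s i, p.2 + if p.1 = s i then 1 else 0) := rfl

theorem s_conj_eq_iff (i : ZMod n) (x y : ExtAffWeyl n) : s i * x * s i = y ↔ x = s i * y * s i := by
  constructor <;> rintro rfl <;> simp [mul_assoc]

/-- Conjugation on signed elements. -/
noncomputable def signedAction : ExtAffWeyl n →* Equiv.Perm (ExtAffWeyl n × ZMod 2) := by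
  classical
  refine lift signedConj
    ((MulAut.conj (rho : ExtAffWeyl n)).toEquiv.prodCongr (Equiv.refl _)) ?_ ?_ ?_ ?_
  · intro i
    ext1 p
    exact (Function.Involutive.toPerm_involutive _) p
  · intro i j h₁ h₂
    have hc := s_comm i j h₁ h₂
    have e1 : s i * s j * s i = s j := by rw [hc, mul_s_mul_s]
    have e2 : s j * s i * s j = s i := by rw [← hc, mul_s_mul_s]
    ext1 p
    simp only [Equiv.Perm.mul_apply, signedConj_apply, s_conj_eq_iff, e1, e2]
    ext
    · calc s i * (s j * p.1 * s j) * s i = (s i * s j) * p.1 * (s j * s i) := by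
            simp only [mul_assoc]
        _ = (s j * s i) * p.1 * (s i * s j) := by rw [hc]
        _ = _ := by simp only [mul_assoc]
    · simp only
      ring
  · intro i
    have h := rho_mul_s i
    ext1 p
    simp only [Equiv.Perm.mul_apply, signedConj_apply, Equiv.prodCongr_apply, Prod.map,
      Equiv.coe_refl, id]
    have e : rho * p.1 * rho⁻¹ = s (i - 1) ↔ p.1 = s i := by
      rw [mul_inv_eq_iff_eq_mul, ← h, mul_right_inj]
    simp only [MulEquiv.toEquiv_eq_coe, EquivLike.coe_coe, MulAut.conj_apply, e]
    ext
    · have h' : s i * rho⁻¹ = rho⁻¹ * s (i - 1) := by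
        rw [mul_inv_eq_iff_eq_mul, mul_assoc, ← h, inv_mul_cancel_left]
      calc rho * (s i * p.1 * s i) * rho⁻¹ = rho * s i * p.1 * (s i * rho⁻¹) := by
            simp only [mul_assoc]
        _ = _ := by rw [h, h']; simp only [mul_assoc]
    · rfl
  · intro hn i
    have hb := braid hn i
    -- Each side of the braid relation tests the element against three reflections. With `e1`, `e2`
    -- and the braid relation these are `s_i`, `s_{i+1}` and `s_i s_{i+1} s_i` on both sides, only
    -- in a different order.
    have e1 : s i * (s (i + 1) * s i * s (i + 1)) * s i = s (i + 1) := by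
      rw [← hb]
      simp [mul_assoc]
    have e2 : s (i + 1) * (s i * s (i + 1) * s i) * s (i + 1) = s i := by
      rw [hb]
      simp [mul_assoc]
    ext1 p
    simp only [Equiv.Perm.mul_apply, signedConj_apply, s_conj_eq_iff, e1, e2]
    ext
    · calc s i * (s (i + 1) * (s i * p.1 * s i) * s (i + 1)) * s i =
            (s i * s (i + 1) * s i) * p.1 * (s i * s (i + 1) * s i) := by simp only [mul_assoc]
        _ = _ := by rw [hb]; simp only [mul_assoc]
    · simp only [hb]
      ring

theorem signedAction_rho (p : ExtAffWeyl n × ZMod 2) :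
    signedAction rho p = (rho * p.1 * rho⁻¹, p.2) := by
  rw [signedAction, lift_rho]
  rfl

theorem signedAction_rho_inv (p : ExtAffWeyl n × ZMod 2) :
    signedAction rho⁻¹ p = (rho⁻¹ * p.1 * rho, p.2) := by
  rw [map_inv, Equiv.Perm.inv_eq_iff_eq, signedAction_rho]
  simp [mul_assoc]

/-- The parity of the number of times that the sign of `x` changes under `w`. -/
noncomputable def inversion (w x : ExtAffWeyl n) : ZMod 2 := (signedAction w (x, 0)).2

/-- Generators only add to the sign, by an amount independent of its current value. This is what
makes `inversion` a cocycle. -/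
theorem signedAction_apply (w x : ExtAffWeyl n) (e : ZMod 2) :
    signedAction w (x, e) = (w * x * w⁻¹, e + inversion w x) := by
  have key (v w : ExtAffWeyl n) : inversion (v * w) x =
      (signedAction v (signedAction w (x, 0))).2 := by
    rw [inversion, map_mul, Equiv.Perm.mul_apply]
  induction w using induction_left generalizing x e with
  | one => simp [inversion]
  | hs i w ih =>
    rw [key, map_mul, Equiv.Perm.mul_apply, ih, ih]
    · simp [signedAction, signedConj_apply, mul_assoc, add_assoc]
    all_goals exact key
  | hr w ih =>
    rw [key, map_mul, Equiv.Perm.mul_apply, ih, ih]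
    · simp [signedAction, mul_assoc]
    all_goals exact key
  | hr' w ih =>
    rw [key, map_mul, Equiv.Perm.mul_apply, ih, ih]
    · rw [signedAction_rho_inv, signedAction_rho_inv]
      simp [mul_assoc]
    all_goals exact key

@[simp] theorem inversion_one (x : ExtAffWeyl n) : inversion 1 x = 0 := by simp [inversion]

theorem inversion_mul (v w x : ExtAffWeyl n) :
    inversion (v * w) x = inversion w x + inversion v (w * x * w⁻¹) := by
  rw [inversion, map_mul, Equiv.Perm.mul_apply, signedAction_apply, signedAction_apply, zero_add]

open Classical in
theorem inversion_s (i : ZMod n) (x : ExtAffWeyl n) :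
    inversion (s i) x = if x = s i then 1 else 0 := by
  simp [inversion, signedAction, signedConj_apply]

@[simp] theorem inversion_rho (x : ExtAffWeyl n) : inversion rho x = 0 := by
  simp [inversion, signedAction]

@[simp] theorem inversion_rho_inv (x : ExtAffWeyl n) : inversion rho⁻¹ x = 0 := by
  have h := inversion_mul rho rho⁻¹ x
  simpa using h.symm

theorem inversion_inv (w x : ExtAffWeyl n) : inversion w⁻¹ (w * x * w⁻¹) = inversion w x := by
  have h := inversion_mul w⁻¹ w x
  rw [inv_mul_cancel, inversion_one] at h
  exact (CharTwo.add_eq_zero.mp h.symm).symm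

/-- `s_i` is a left descent of `w`. -/
def IsDescent (i : ZMod n) (w : ExtAffWeyl n) : Prop := inversion w⁻¹ (s i) = 1

theorem not_isDescent_iff {i : ZMod n} {w : ExtAffWeyl n} :
    ¬ IsDescent i w ↔ inversion w⁻¹ (s i) = 0 := by
  unfold IsDescent
  generalize inversion w⁻¹ (s i) = x
  revert x
  decide

theorem not_isDescent_one (i : ZMod n) : ¬ IsDescent i 1 := by
  simp [IsDescent]

/-- In the cocycle identity the factor `s_i` contributes exactly one sign change at the reflection
`s_i`, so left multiplication toggles the descent. -/
theorem isDescent_s_mul (i : ZMod n) (w : ExtAffWeyl n) :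
    IsDescent i (s i * w) ↔ ¬ IsDescent i w := by
  rw [not_isDescent_iff, IsDescent, mul_inv_rev, s_inv, inversion_mul, inversion_s]
  simp only [s_inv, mul_s_mul_s, if_true]
  generalize inversion w⁻¹ (s i) = x
  revert x
  decide

/-- The extra term of the cocycle is the inversion of `s_j` at `w⁻¹ s_i w`, which is nonzero only if
that conjugate is `s_j`. -/
theorem isDescent_mul_s {i j : ZMod n} {w : ExtAffWeyl n} (h : s i * w ≠ w * s j) :
    IsDescent i (w * s j) ↔ IsDescent i w := by
  rw [IsDescent, mul_inv_rev, s_inv, inversion_mul, inversion_s, if_neg, add_zero, IsDescent]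
  intro h'
  apply h
  rw [← h']
  group

theorem isDescent_inv_of_eq {i j : ZMod n} {w : ExtAffWeyl n} (h : s i * w = w * s j) :
    IsDescent j w⁻¹ ↔ IsDescent i w := by
  rw [IsDescent, IsDescent, inv_inv, ← inversion_inv, ← h, mul_inv_cancel_right]

theorem isDescent_rho_mul (i : ZMod n) (w : ExtAffWeyl n) :
    IsDescent (i - 1) (rho * w) ↔ IsDescent i w := by
  rw [IsDescent, mul_inv_rev, inversion_mul, inversion_rho_inv, zero_add, inv_inv, mul_assoc,
    ← rho_mul_s, inv_mul_cancel_left, IsDescent]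

theorem isDescent_mul_rho (i : ZMod n) (w : ExtAffWeyl n) :
    IsDescent i (w * rho) ↔ IsDescent i w := by
  rw [IsDescent, mul_inv_rev, inversion_mul, inversion_rho_inv, add_zero, IsDescent]

theorem isDescent_mul_rho_inv (i : ZMod n) (w : ExtAffWeyl n) :
    IsDescent i (w * rho⁻¹) ↔ IsDescent i w := by
  rw [IsDescent, mul_inv_rev, inversion_mul, inv_inv, inversion_rho, add_zero, IsDescent]

/-- The strong exchange property. -/
theorem exists_eraseIdx (l : List (ZMod n)) (x : ExtAffWeyl n)
    (h : inversion (sWord l)⁻¹ x = 1) :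
    ∃ k < l.length, x * sWord l = sWord (l.eraseIdx k) := by
  classical
  induction l generalizing x with
  | nil => simp at h
  | cons j l ih =>
    rw [sWord_cons, mul_inv_rev, s_inv, inversion_mul, inversion_s] at h
    by_cases hx : x = s j
    -- If the sign changes at the first letter, that letter is erased; otherwise `x` is conjugated
    -- past it and the search continues in the tail.
    · exact ⟨0, by simp, by simp [hx]⟩
    · rw [if_neg hx, zero_add, s_inv] at h
      obtain ⟨k, hk, e⟩ := ih _ h
      refine ⟨k + 1, by simpa using hk, ?_⟩
      simp only [List.eraseIdx_cons_succ, sWord_cons, ← e]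
      simp [mul_assoc]

/-! ### Reduced words -/

/-- Words of minimal length among those representing the same element. -/
def IsReduced (l : List (ZMod n)) : Prop := l.length = affLength (sWord l)

theorem affLength_sWord_le (l l' : List (ZMod n)) (h : sWord l' = sWord l) :
    affLength (sWord l) ≤ l'.length :=
  Nat.sInf_le ⟨l', rfl, h⟩

theorem exists_isReduced (l : List (ZMod n)) : ∃ l', sWord l' = sWord l ∧ IsReduced l' := by
  obtain ⟨l', h₁, h₂⟩ := Nat.sInf_mem (s := {m | ∃ l' : List (ZMod n), l'.length = m ∧
    sWord l' = sWord l}) ⟨_, l, rfl, rfl⟩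
  exact ⟨l', h₂, by rw [IsReduced, h₂]; exact h₁⟩

theorem isReduced_iff {l : List (ZMod n)} :
    IsReduced l ↔ ∀ l', sWord l' = sWord l → l.length ≤ l'.length := by
  constructor
  · intro h l' h'
    exact h.trans_le (affLength_sWord_le _ _ h')
  · intro h
    obtain ⟨l', h₁, h₂⟩ := exists_isReduced l
    apply le_antisymm _ (affLength_sWord_le _ _ rfl)
    rw [← h₁, ← h₂]
    exact h _ h₁

theorem IsReduced.of_length_le {l l' : List (ZMod n)} (h : IsReduced l)
    (h' : sWord l' = sWord l) (hl : l'.length ≤ l.length) : IsReduced l' :=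
  isReduced_iff.2 fun _ e => hl.trans (isReduced_iff.1 h _ (e.trans h'))

theorem IsReduced.tail {i : ZMod n} {l : List (ZMod n)} (h : IsReduced (i :: l)) :
    IsReduced l :=
  isReduced_iff.2 fun l' e => by
    simpa using isReduced_iff.1 h (i :: l') (by simp [e])

theorem IsDescent.exists_eraseIdx {i : ZMod n} {l : List (ZMod n)} (h : IsDescent i (sWord l)) :
    ∃ k < l.length, s i * sWord l = sWord (l.eraseIdx k) :=
  ExtAffWeyl.exists_eraseIdx l (s i) h

/-- Otherwise exchange would erase a letter of `l` and leave a word for `s_i w` that is shorter by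
two than `i :: l`. -/
theorem IsReduced.not_isDescent {i : ZMod n} {l : List (ZMod n)} (h : IsReduced (i :: l)) :
    ¬ IsDescent i (sWord l) := by
  intro hd
  obtain ⟨k, hk, e⟩ := hd.exists_eraseIdx
  have := isReduced_iff.1 h (l.eraseIdx k) (by simp [e])
  rw [List.length_eraseIdx_of_lt hk, List.length_cons] at this
  omega

theorem IsReduced.isDescent {i : ZMod n} {l : List (ZMod n)} (h : IsReduced (i :: l)) :
    IsDescent i (sWord (i :: l)) := by
  rw [sWord_cons, isDescent_s_mul]
  exact h.not_isDescent

/-- Any competing word for `s_i w` has `s_i` as a descent, so exchange removes one of its letters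
and produces a word for `w`, which cannot be shorter than `l`. -/
theorem IsReduced.cons {i : ZMod n} {l : List (ZMod n)} (h : IsReduced l)
    (hd : ¬ IsDescent i (sWord l)) : IsReduced (i :: l) :=
  isReduced_iff.2 fun l' e => by
    rw [sWord_cons] at e
    have hd' : IsDescent i (sWord l') := by rwa [e, isDescent_s_mul]
    obtain ⟨k, hk, e'⟩ := hd'.exists_eraseIdx
    have := isReduced_iff.1 h (l'.eraseIdx k) (by simp [← e', e])
    rw [List.length_eraseIdx_of_lt hk] at this
    rw [List.length_cons]
    omega

end ExtAffWeyl

end AffineYokonuma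

namespace AffineYokonuma

namespace ExtAffWeyl

variable {n : ℕ}

/-! ### The permutation of the indices -/

theorem zmod_one_ne_zero (hn : 2 ≤ n) : (1 : ZMod n) ≠ 0 := by
  have : Fact (1 < n) := ⟨hn⟩
  exact one_ne_zero

theorem zmod_two_ne_zero (hn : 3 ≤ n) : (1 + 1 : ZMod n) ≠ 0 := by
  intro h
  have h' : ((2 : ℕ) : ZMod n) = 0 := by rw [← h]; norm_num
  rw [ZMod.natCast_eq_zero_iff] at h'
  exact absurd (Nat.le_of_dvd (by norm_num) h') (by omega)

/-- The action on the indices, `s_i ↦ (i, i + 1)` and `ρ ↦ (j ↦ j - 1)`. -/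
def perm (n : ℕ) : ExtAffWeyl n →* Equiv.Perm (ZMod n) :=
  lift (fun i => Equiv.swap i (i + 1)) (Equiv.subRight 1) (by simp)
    (by
      intro i j h₁ h₂
      by_cases hij : i = j
      · rw [hij]
      · ext1 x
        simp only [Equiv.Perm.mul_apply, Equiv.swap_apply_def]
        grind)
    (by
      intro i
      ext1 x
      simp only [Equiv.Perm.mul_apply, Equiv.swap_apply_def, Equiv.subRight_apply]
      grind)
    (by
      intro hn i
      have h₁ := zmod_one_ne_zero (n := n) (by omega)
      have h₂ := zmod_two_ne_zero hn
      ext1 x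
      simp only [Equiv.Perm.mul_apply, Equiv.swap_apply_def]
      grind)

@[simp] theorem perm_s (i : ZMod n) : perm n (s i) = Equiv.swap i (i + 1) := by
  rw [perm, lift_s]

@[simp] theorem perm_rho : perm n rho = Equiv.subRight 1 := by
  rw [perm, lift_rho]

/-- This fails for `n = 2`, where both generators act as the same transposition; that case needs the
action on the line below. -/
theorem swap_succ_injective (hn : 3 ≤ n) {i j : ZMod n}
    (h : Equiv.swap i (i + 1) = Equiv.swap j (j + 1)) : i = j := by
  have h₁ := zmod_one_ne_zero (n := n) (by omega)
  have h₂ := zmod_two_ne_zero hn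
  have e₁ := congrArg (fun σ : Equiv.Perm (ZMod n) => σ i) h
  have h₃ : i + 1 ≠ i := by simpa using h₁
  have h₄ : i + 1 + 1 ≠ i := by simpa [add_assoc] using h₂
  simp only [Equiv.swap_apply_def, if_true] at e₁
  split_ifs at e₁ with c₁ c₂
  · exact c₁
  · exact absurd (by rw [e₁, ← c₂]) h₄
  · exact absurd e₁ h₃

theorem s_mul_s_succ_ne (hn : 3 ≤ n) (i : ZMod n) : s i * s (i + 1) ≠ s (i + 1) * s i := by
  intro h
  have h₁ := zmod_one_ne_zero (n := n) (by omega)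
  have h₂ := zmod_two_ne_zero hn
  have e := congrArg (fun w => perm n w i) h
  have h₃ : i + 1 ≠ i := by simpa using h₁
  have h₄ : i ≠ i + 1 + 1 := by simpa [add_assoc] using h₂
  simp only [map_mul, perm_s, Equiv.Perm.mul_apply, Equiv.swap_apply_left,
    Equiv.swap_apply_of_ne_of_ne h₃.symm h₄] at e
  exact h₁ (by simpa using e)

/-! ### The infinite dihedral case -/

theorem zmod_two_eq_zero_or (i : ZMod 2) : i = 0 ∨ i = 1 := by revert i; decide

/-- The action of the extended affine Weyl group on the line for `n = 2`. -/
def lineAction : ExtAffWeyl 2 →* Equiv.Perm ℤ :=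
  -- The generators `s_0` and `s_1` are the reflections of the line in `0` and `2`, and `ρ` is the
  -- reflection in the midpoint `1`, which interchanges them.
  lift (fun i => if i = 0 then Equiv.subLeft 0 else Equiv.subLeft 4) (Equiv.subLeft 2)
    (by
      intro i
      ext x
      split_ifs <;> simp)
    (by
      intro i j h₁ _
      have : i = j := by revert i j; decide
      rw [this])
    (by
      intro i
      ext x
      rcases zmod_two_eq_zero_or i with rfl | rfl
      · simp [Equiv.Perm.mul_apply]
        ring
      · simp [Equiv.Perm.mul_apply]
        ring)
    (by omega)

theorem lineAction_s_zero (x : ℤ) : lineAction (s 0) x = -x := by simp [lineAction]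

theorem lineAction_s_one (x : ℤ) : lineAction (s 1) x = 4 - x := by simp [lineAction]

/-- Ping-pong with base point `1`: letters of a reduced word alternate, `s_0` sends points beyond
`2` to negative points, and `s_1` sends negative points beyond `2`. The side on which the image lies
reveals the first letter. -/
theorem IsReduced.lineAction_pos {i : ZMod 2} {l : List (ZMod 2)} (h : IsReduced (i :: l)) :
    (i = 0 → lineAction (sWord (i :: l)) 1 < 0) ∧ (i = 1 → 2 < lineAction (sWord (i :: l)) 1) := by
  induction l generalizing i with
  | nil =>
    constructor <;> rintro rfl <;> simp [lineAction_s_zero, lineAction_s_one]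
  | cons j l ih =>
    have hij : i ≠ j := by
      rintro rfl
      exact h.not_isDescent h.tail.isDescent
    obtain ⟨h₀, h₁⟩ := ih h.tail
    rcases zmod_two_eq_zero_or i with rfl | rfl <;> rcases zmod_two_eq_zero_or j with rfl | rfl
    · exact absurd rfl hij
    · have := h₁ rfl
      refine ⟨fun _ => ?_, fun h => absurd h (by decide)⟩
      rw [sWord_cons, map_mul, Equiv.Perm.mul_apply, lineAction_s_zero]
      omega
    · have := h₀ rfl
      refine ⟨fun h => absurd h (by decide), fun _ => ?_⟩
      rw [sWord_cons, map_mul, Equiv.Perm.mul_apply, lineAction_s_one]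
      omega
    · exact absurd rfl hij

/-- In the infinite dihedral case two reduced words of one element cannot start differently, so the
word property needs no braid relation for `n = 2`. -/
theorem IsReduced.head_eq_of_two {i j : ZMod 2} {l l' : List (ZMod 2)} (h : IsReduced (i :: l))
    (h' : IsReduced (j :: l')) (e : sWord (i :: l) = sWord (j :: l')) : i = j := by
  obtain ⟨h₀, h₁⟩ := h.lineAction_pos
  obtain ⟨h₀', h₁'⟩ := h'.lineAction_pos
  rw [e] at h₀ h₁
  by_contra hij
  rcases zmod_two_eq_zero_or i with rfl | rfl <;> rcases zmod_two_eq_zero_or j with rfl | rfl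
  · exact hij rfl
  · have := h₀ rfl
    have := h₁' rfl
    omega
  · have := h₁ rfl
    have := h₀' rfl
    omega
  · exact hij rfl

theorem s_injective (hn : 2 ≤ n) : Function.Injective (s (n := n)) := by
  intro i j h
  rcases hn.eq_or_lt with rfl | hn
  · have e : lineAction (s i) 1 = lineAction (s j) 1 := by rw [h]
    rcases zmod_two_eq_zero_or i with rfl | rfl <;> rcases zmod_two_eq_zero_or j with rfl | rfl
    · rfl
    · simp [lineAction_s_zero, lineAction_s_one] at e
    · simp [lineAction_s_zero, lineAction_s_one] at e
    · rfl
  · apply swap_succ_injective hn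
    rw [← perm_s, h, perm_s]

/-! ### The word property -/

section Matsumoto

variable {M : Type*} [Monoid M] {f : ZMod n → M}

/-- Exchange with `s_j` erases a letter of `i :: u`. It is not the first one, since that would force
`s_j = s_i`; hence the initial `i` survives. -/
theorem exists_of_isReduced_of_ne {i j : ZMod n} {u v : List (ZMod n)} (hn : 2 ≤ n)
    (h' : IsReduced (j :: v)) (e : sWord (i :: u) = sWord (j :: v))
    (hij : i ≠ j) : ∃ u' : List (ZMod n), u'.length + 1 = u.length ∧
      s j * sWord (i :: u) = s i * sWord u' := by
  have hd : IsDescent j (sWord (i :: u)) := by rw [e]; exact h'.isDescent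
  obtain ⟨k, hk, ek⟩ := hd.exists_eraseIdx
  rcases k with - | k
  · rw [sWord_cons, List.eraseIdx_cons_zero, ← mul_assoc, mul_eq_right] at ek
    have := eq_inv_of_mul_eq_one_right ek
    rw [s_inv] at this
    exact absurd (s_injective hn this) hij
  · rw [List.length_cons, Nat.succ_lt_succ_iff] at hk
    refine ⟨u.eraseIdx k, ?_, ?_⟩
    · rw [List.length_eraseIdx_of_lt hk]
      omega
    · rw [ek, List.eraseIdx_cons_succ, sWord_cons]

/-- The word property (Matsumoto): a product along a reduced word of elements which satisfy the
braid relations depends on the element represented by the word only. -/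
theorem IsReduced.prod_map_eq (hn : 2 ≤ n)
    (hcomm : ∀ i j, i - j ≠ 1 → i - j ≠ -1 → f i * f j = f j * f i)
    (hbraid : 3 ≤ n → ∀ i, f i * f (i + 1) * f i = f (i + 1) * f i * f (i + 1))
    {l l' : List (ZMod n)} (h : IsReduced l) (h' : IsReduced l') (e : sWord l = sWord l') :
    (l.map f).prod = (l'.map f).prod := by
  have hlen : l.length = l'.length := by rw [h, h', e]
  induction hm : l.length using Nat.strong_induction_on generalizing l l' with
  | _ m ih =>
  have IH : ∀ {a b : List (ZMod n)}, IsReduced a → sWord b = sWord a → a.length < m →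
      b.length = a.length → (a.map f).prod = (b.map f).prod := fun {a b} ha hab hlt hl =>
    ih _ hlt ha (ha.of_length_le hab hl.le) hab.symm hl.symm rfl
  rcases l with - | ⟨i, u⟩
  · rw [List.eq_nil_of_length_eq_zero hlen.symm]
  rcases l' with - | ⟨j, v⟩
  · simp at hlen
  simp only [List.length_cons] at hm hlen
  simp only [List.map_cons, List.prod_cons]
  by_cases hij : i = j
  · subst hij
    congr 1
    exact IH h.tail (by simpa using e.symm) (by omega) (by omega)
  -- For different first letters, `v` and `i :: u'` represent the same element, so the element
  -- itself is also represented by `j :: i :: u'`. It remains to compare this with `i :: u`.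
  obtain ⟨u', hu', eu'⟩ := exists_of_isReduced_of_ne hn h' e hij
  have ev : sWord v = s i * sWord u' := by
    rw [← eu', e, sWord_cons, s_mul_s_mul]
  have eu : s i * sWord u = s j * (s i * sWord u') := by
    rw [← eu', s_mul_s_mul, sWord_cons]
  have pv : (v.map f).prod = f i * (u'.map f).prod := by
    rw [IH (b := i :: u') h'.tail (by rw [sWord_cons, ev]) (by omega)
      (by rw [List.length_cons]; omega), List.map_cons, List.prod_cons]
  by_cases hc : i - j ≠ 1 ∧ i - j ≠ -1
  · have pu : (u.map f).prod = f j * (u'.map f).prod := by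
      rw [IH (b := j :: u') h.tail ?_ (by omega) (by rw [List.length_cons]; omega), List.map_cons,
        List.prod_cons]
      rw [sWord_cons, ← mul_right_inj (s i), eu, ← mul_assoc, ← mul_assoc, s_comm i j hc.1 hc.2]
    rw [pu, pv, ← mul_assoc, ← mul_assoc, hcomm i j hc.1 hc.2]
  rcases hn.eq_or_lt with rfl | hn3
  · exact absurd (h.head_eq_of_two h' e) hij
  have hadj : i = j + 1 ∨ j = i + 1 := by grind
  have hsij : s i * s j ≠ s j * s i := by
    rcases hadj with rfl | rfl
    · exact (s_mul_s_succ_ne hn3 j).symm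
    · exact s_mul_s_succ_ne hn3 i
  have hb : s i * (s j * s i) = s j * (s i * s j) := by
    simp only [← mul_assoc]
    rcases hadj with rfl | rfl
    · exact (braid hn3 j).symm
    · exact braid hn3 i
  have hbf : f i * (f j * f i) = f j * (f i * f j) := by
    simp only [← mul_assoc]
    rcases hadj with rfl | rfl
    · exact (hbraid hn3 j).symm
    · exact hbraid hn3 i
  have hd : IsDescent i (sWord (j :: i :: u')) := by
    rw [sWord_cons, sWord_cons, ← eu, ← sWord_cons]
    exact h.isDescent
  -- A second exchange, now with `s_i` in `j :: i :: u'`. Erasing `j` contradicts reducedness,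
  -- erasing `i` makes `s_i` and `s_j` commute, so the erased letter lies in `u'`. With `z` the
  -- remainder, the two words can be replaced by `i j i z` and `j i j z`.
  obtain ⟨k, hk, ek⟩ := hd.exists_eraseIdx
  rcases k with - | - | k
  · have : sWord u = s i * sWord u' := by
      simpa [← eu] using ek
    have := isReduced_iff.1 h u' (by rw [sWord_cons, this, s_mul_s_mul])
    simp only [List.length_cons] at this
    omega
  · have : s i * (s j * (s i * sWord u')) = s j * sWord u' := by
      simpa using ek
    refine absurd ?_ hsij
    have h2 : s j * (s i * sWord u') = s i * (s j * sWord u') := by rw [← this, s_mul_s_mul]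
    rw [← mul_assoc, ← mul_assoc] at h2
    exact (mul_right_cancel h2).symm
  · simp only [List.length_cons] at hk
    have hk' : k < u'.length := by omega
    simp only [List.eraseIdx_cons_succ, sWord_cons, ← eu, s_mul_s_mul] at ek
    set z := u'.eraseIdx k with hz
    have hzl : z.length + 1 = u'.length := by
      rw [hz, List.length_eraseIdx_of_lt hk']
      omega
    have pu : (u.map f).prod = f j * (f i * (z.map f).prod) := by
      rw [IH (b := j :: i :: z) h.tail (by simp [ek]) (by omega)
        (by simp only [List.length_cons]; omega)]
      simp
    have pv' : (v.map f).prod = f i * (f j * (z.map f).prod) := by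
      rw [IH (b := i :: j :: z) h'.tail ?_ (by omega) (by simp only [List.length_cons]; omega)]
      · simp
      · rw [ev, ← mul_right_inj (s j), ← eu, ek]
        simp only [sWord_cons, ← mul_assoc] at hb ⊢
        rw [hb]
    rw [pu, pv']
    simp only [← mul_assoc] at hbf ⊢
    rw [hbf]

end Matsumoto

end ExtAffWeyl

end AffineYokonuma

namespace AffineYokonuma

open ExtAffWeyl

/-! ### Hecke operators with coefficients -/

section HeckeOperators

variable {n : ℕ} {R A : Type*} [CommRing R] [CommRing A] [Algebra R A]

open Classical in
/-- The parameter `c_i` if `s_i` is a left descent of `w`, and `0` otherwise. -/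
noncomputable def descentCoeff (c : ZMod n → A) (i : ZMod n) (w : ExtAffWeyl n) : A :=
  if IsDescent i w then c i else 0

theorem descentCoeff_of_not {c : ZMod n → A} {i : ZMod n} {w : ExtAffWeyl n}
    (h : ¬ IsDescent i w) : descentCoeff c i w = 0 := by
  rw [descentCoeff, if_neg h]

theorem descentCoeff_of {c : ZMod n → A} {i : ZMod n} {w : ExtAffWeyl n}
    (h : IsDescent i w) : descentCoeff c i w = c i := by
  rw [descentCoeff, if_pos h]

theorem descentCoeff_congr {c : ZMod n → A} {i : ZMod n} {w w' : ExtAffWeyl n}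
    (h : IsDescent i w ↔ IsDescent i w') : descentCoeff c i w = descentCoeff c i w' := by
  rw [descentCoeff, descentCoeff, propext h]

theorem descentCoeff_mul_self (c : ZMod n → A) (i : ZMod n) (w : ExtAffWeyl n) :
    descentCoeff c i w * descentCoeff c i w = c i * descentCoeff c i w := by
  unfold descentCoeff
  split_ifs <;> simp

/-- Exactly one of `w` and `s_i w` has `s_i` as a left descent. -/
theorem descentCoeff_s_mul (c : ZMod n → A) (i : ZMod n) (w : ExtAffWeyl n) :
    descentCoeff c i (s i * w) + descentCoeff c i w = c i := by
  by_cases h : IsDescent i w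
  · rw [descentCoeff_of_not ((isDescent_s_mul i w).not.2 (not_not.2 h)), descentCoeff_of h, zero_add]
  · rw [descentCoeff_of_not h, descentCoeff_of ((isDescent_s_mul i w).2 h), add_zero]

/-- Left multiplication by `T_{s_i}` on the free module on the extended affine Weyl group. -/
noncomputable def leftOp (act : ExtAffWeyl n →* (A ≃ₐ[R] A)) (c : ZMod n → A) (i : ZMod n) :
    (ExtAffWeyl n →₀ A) →ₗ[R] (ExtAffWeyl n →₀ A) :=
  Finsupp.lsum R fun w => Finsupp.lsingle (s i * w) ∘ₗ (act (s i)).toLinearMap +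
    Finsupp.lsingle w ∘ₗ LinearMap.mulLeft R (descentCoeff c i w)

/-- Left multiplication by an element whose powers are length preserving. -/
noncomputable def leftMul (act : ExtAffWeyl n →* (A ≃ₐ[R] A)) (x : ExtAffWeyl n) :
    (ExtAffWeyl n →₀ A) →ₗ[R] (ExtAffWeyl n →₀ A) :=
  Finsupp.lsum R fun w => Finsupp.lsingle (x * w) ∘ₗ (act x).toLinearMap

/-- Right multiplication by `T_{s_j}` on the free module on the extended affine Weyl group. -/
noncomputable def rightOp (act : ExtAffWeyl n →* (A ≃ₐ[R] A)) (c : ZMod n → A) (j : ZMod n) :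
    (ExtAffWeyl n →₀ A) →ₗ[R] (ExtAffWeyl n →₀ A) :=
  Finsupp.lsum R fun w => Finsupp.lsingle (w * s j) +
    Finsupp.lsingle w ∘ₗ LinearMap.mulLeft R (act w (descentCoeff c j w⁻¹))

variable (R A) in
/-- Right multiplication by an element whose powers are length preserving. -/
noncomputable def rightMul (x : ExtAffWeyl n) :
    (ExtAffWeyl n →₀ A) →ₗ[R] (ExtAffWeyl n →₀ A) :=
  Finsupp.lsum R fun w => Finsupp.lsingle (w * x)

/-! ### Formulas on basis vectors, and commutation of left with right operators -/

variable {act : ExtAffWeyl n →* (A ≃ₐ[R] A)} {c : ZMod n → A}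

@[simp] theorem leftOp_single (i : ZMod n) (w : ExtAffWeyl n) (a : A) :
    leftOp act c i (Finsupp.single w a) = Finsupp.single (s i * w) (act (s i) a) +
      Finsupp.single w (descentCoeff c i w * a) := by
  simp [leftOp]

@[simp] theorem leftMul_single (x w : ExtAffWeyl n) (a : A) :
    leftMul act x (Finsupp.single w a) = Finsupp.single (x * w) (act x a) := by
  simp [leftMul]

@[simp] theorem rightOp_single (j : ZMod n) (w : ExtAffWeyl n) (a : A) :
    rightOp act c j (Finsupp.single w a) = Finsupp.single (w * s j) a +
      Finsupp.single w (act w (descentCoeff c j w⁻¹) * a) := by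
  simp [rightOp]

@[simp] theorem rightMul_single (x w : ExtAffWeyl n) (a : A) :
    rightMul R A x (Finsupp.single w a) = Finsupp.single (w * x) a := by
  simp [rightMul]

theorem leftOp_single_one {i : ZMod n} {w : ExtAffWeyl n} (h : ¬ IsDescent i w) :
    leftOp act c i (Finsupp.single w 1) = Finsupp.single (s i * w) 1 := by
  simp [descentCoeff_of_not h]

theorem act_s_act_s (i : ZMod n) (a : A) : act (s i) (act (s i) a) = a := by
  rw [← AlgEquiv.mul_apply, ← map_mul, s_mul_self, map_one, AlgEquiv.one_apply]

theorem leftMul_mul (x y : ExtAffWeyl n) (v : ExtAffWeyl n →₀ A) :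
    leftMul act x (leftMul act y v) = leftMul act (x * y) v := by
  suffices h : leftMul act x ∘ₗ leftMul act y = leftMul act (x * y) from
    LinearMap.congr_fun h v
  ext1 w
  ext1 a
  simp [mul_assoc]

theorem leftMul_one (v : ExtAffWeyl n →₀ A) : leftMul act 1 v = v := by
  suffices h : leftMul act 1 = LinearMap.id from LinearMap.congr_fun h v
  ext1 w
  ext1 a
  simp

theorem act_descentCoeff {i j : ZMod n} {x w w' : ExtAffWeyl n}
    (h : IsDescent j w ↔ IsDescent i w') (hx : act x (c j) = c i) :
    act x (descentCoeff c j w) = descentCoeff c i w' := by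
  by_cases hd : IsDescent j w
  · rw [descentCoeff_of hd, descentCoeff_of (h.1 hd), hx]
  · rw [descentCoeff_of_not hd, descentCoeff_of_not (h.not.1 hd), map_zero]

-- The two compatibilities required of the parameters: conjugate simple reflections have
-- corresponding parameters, and `c_i` does not distinguish a coefficient from its image under
-- `s_i`.
variable (h₁ : ∀ w i j, s i * w = w * s j → act w (c j) = c i)
  (h₂ : ∀ i a, c i * act (s i) a = c i * a)

include h₁ in
theorem act_s_descentCoeff (i : ZMod n) (w : ExtAffWeyl n) :
    act (s i) (descentCoeff c i w) = descentCoeff c i w :=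
  act_descentCoeff Iff.rfl (h₁ _ _ _ rfl)

include h₁ in
theorem act_rho_descentCoeff (i : ZMod n) (w : ExtAffWeyl n) :
    act rho (descentCoeff c i w) = descentCoeff c (i - 1) (rho * w) :=
  act_descentCoeff (isDescent_rho_mul i w).symm (h₁ _ _ _ (rho_mul_s i).symm)

include h₂ in
theorem descentCoeff_mul_act (i : ZMod n) (w : ExtAffWeyl n) (a : A) :
    descentCoeff c i w * act (s i) a = descentCoeff c i w * a := by
  unfold descentCoeff
  split_ifs
  · exact h₂ i a
  · simp

include h₁ h₂ in
theorem leftOp_rightOp (i j : ZMod n) (v : ExtAffWeyl n →₀ A) :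
    leftOp act c i (rightOp act c j v) = rightOp act c j (leftOp act c i v) := by
  suffices h : leftOp act c i ∘ₗ rightOp act c j = rightOp act c j ∘ₗ leftOp act c i from
    LinearMap.congr_fun h v
  ext1 w
  ext1 a
  simp only [LinearMap.comp_apply, Finsupp.lsingle_apply, rightOp_single, leftOp_single, map_add]
  -- If `s_i w = w s_j`, left descent at `i` and right descent at `j` coincide, for `w` and for `s_i
  -- w`, and `h₁` matches the coefficients. Otherwise neither multiplication affects the descent
  -- relevant to the other one.
  by_cases hw : s i * w = w * s j
  · have e : act (s i * w) (c j) = c i := h₁ _ _ _ (by rw [mul_assoc, ← hw])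
    have e2 : act w (descentCoeff c j w⁻¹) = descentCoeff c i w :=
      act_descentCoeff (isDescent_inv_of_eq hw) (h₁ _ _ _ hw)
    have e3 : act (s i * w) (descentCoeff c j (s i * w)⁻¹) = descentCoeff c i (s i * w) :=
      act_descentCoeff (isDescent_inv_of_eq (by rw [mul_assoc, ← hw])) e
    rw [← hw, mul_assoc (s i) w (s j), ← hw, e2, e3]
    simp only [map_mul, act_s_descentCoeff h₁, descentCoeff_mul_act h₂]
  · have e1 : descentCoeff c i (w * s j) = descentCoeff c i w :=
      descentCoeff_congr (isDescent_mul_s hw)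
    have e2 : descentCoeff c j (s i * w)⁻¹ = descentCoeff c j w⁻¹ := by
      rw [mul_inv_rev, s_inv]
      apply descentCoeff_congr (isDescent_mul_s _)
      intro h
      apply hw
      have := congrArg (fun x => w * x * w) h
      simpa [mul_assoc] using this.symm
    rw [e1, e2, ← mul_assoc (s i) w (s j), map_mul act, AlgEquiv.mul_apply, map_mul,
      mul_left_comm (descentCoeff c i w)]
    abel

theorem leftOp_rightMul {x : ExtAffWeyl n} (hx : ∀ i w, IsDescent i (w * x) ↔ IsDescent i w)
    (i : ZMod n) (v : ExtAffWeyl n →₀ A) :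
    leftOp act c i (rightMul R A x v) = rightMul R A x (leftOp act c i v) := by
  suffices h : leftOp act c i ∘ₗ rightMul R A x = rightMul R A x ∘ₗ leftOp act c i from
    LinearMap.congr_fun h v
  ext1 w
  ext1 a
  simp only [LinearMap.comp_apply, Finsupp.lsingle_apply, rightMul_single, leftOp_single, map_add,
    mul_assoc, descentCoeff_congr (c := c) (hx i w)]

include h₂ in
theorem leftOp_smul (i : ZMod n) (x : A) (v : ExtAffWeyl n →₀ A) :
    leftOp act c i (x • v) = act (s i) x • leftOp act c i v := by
  induction v using Finsupp.induction_linear with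
  | zero => simp
  | add v w hv hw => simp only [smul_add, map_add, hv, hw]
  | single w a =>
    simp only [Finsupp.smul_single, smul_eq_mul, leftOp_single, smul_add, map_mul]
    rw [mul_left_comm (act (s i) x), ← mul_assoc (descentCoeff c i w) (act (s i) x),
      descentCoeff_mul_act h₂, mul_assoc]

theorem leftMul_smul (y : ExtAffWeyl n) (x : A) (v : ExtAffWeyl n →₀ A) :
    leftMul act y (x • v) = act y x • leftMul act y v := by
  induction v using Finsupp.induction_linear with
  | zero => simp
  | add v w hv hw => simp only [smul_add, map_add, hv, hw]
  | single w a => simp only [Finsupp.smul_single, smul_eq_mul, leftMul_single, map_mul]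

include h₁ in
theorem leftOp_leftOp_self (i : ZMod n) (v : ExtAffWeyl n →₀ A) :
    leftOp act c i (leftOp act c i v) = v + c i • leftOp act c i v := by
  induction v using Finsupp.induction_linear with
  | zero => simp
  | add v w hv hw =>
    simp only [smul_add, map_add, hv, hw]
    abel
  | single w a =>
    simp only [leftOp_single, map_add, s_mul_s_mul, act_s_act_s, map_mul,
      act_s_descentCoeff h₁, Finsupp.smul_single, smul_add, smul_eq_mul]
    rw [← mul_assoc, descentCoeff_mul_self, ← mul_assoc, add_assoc]
    congr 1
    -- The two terms at `s_i w` carry the descent coefficients of `w` and of `s_i w`, which add up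
    -- to `c_i`.
    rw [← add_assoc, ← Finsupp.single_add, ← add_mul, descentCoeff_s_mul]

include h₁ in
theorem leftMul_rho_leftOp (i : ZMod n) (v : ExtAffWeyl n →₀ A) :
    leftMul act rho (leftOp act c i v) = leftOp act c (i - 1) (leftMul act rho v) := by
  suffices h : leftMul act rho ∘ₗ leftOp act c i = leftOp act c (i - 1) ∘ₗ leftMul act rho from
    LinearMap.congr_fun h v
  ext1 w
  ext1 a
  simp only [LinearMap.comp_apply, Finsupp.lsingle_apply, leftMul_single, leftOp_single, map_add,
    map_mul, act_rho_descentCoeff h₁]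
  rw [← mul_assoc, rho_mul_s, mul_assoc, ← AlgEquiv.mul_apply, ← AlgEquiv.mul_apply, ← map_mul act,
    ← map_mul act, rho_mul_s]

/-- Semilinear operators which commute with right multiplications are determined by their value
at the identity. -/
theorem eq_of_commute_right {X Y : (ExtAffWeyl n →₀ A) →ₗ[R] (ExtAffWeyl n →₀ A)} {g : A → A}
    (hX : ∀ a v, X (a • v) = g a • X v) (hY : ∀ a v, Y (a • v) = g a • Y v)
    (hXs : ∀ j v, X (rightOp act c j v) = rightOp act c j (X v))
    (hYs : ∀ j v, Y (rightOp act c j v) = rightOp act c j (Y v))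
    (hXr : ∀ v, X (rightMul R A rho v) = rightMul R A rho (X v))
    (hYr : ∀ v, Y (rightMul R A rho v) = rightMul R A rho (Y v))
    (hXr' : ∀ v, X (rightMul R A rho⁻¹ v) = rightMul R A rho⁻¹ (X v))
    (hYr' : ∀ v, Y (rightMul R A rho⁻¹ v) = rightMul R A rho⁻¹ (Y v))
    (h : X (Finsupp.single 1 1) = Y (Finsupp.single 1 1)) : X = Y := by
  have hsmul : ∀ (w : ExtAffWeyl n) (a : A),
      X (Finsupp.single w 1) = Y (Finsupp.single w 1) →
        X (Finsupp.single w a) = Y (Finsupp.single w a) := by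
    intro w a hw
    have : Finsupp.single w a = a • Finsupp.single w (1 : A) := by simp
    rw [this, hX, hY, hw]
  ext1 w
  ext1 a
  refine hsmul w a ?_
  induction w using induction_right with
  | one => exact h
  | hs j w ih =>
    -- Right multiplication by `T_{s_j}` sends the vector at `w` to the vector at `w s_j` plus a
    -- multiple of the vector at `w`. Agreement on the second term is known, so it can be cancelled.
    have hx := hXs j (Finsupp.single w 1)
    have hy := hYs j (Finsupp.single w 1)
    rw [rightOp_single, map_add] at hx hy
    rw [ih, ← hy, hsmul w _ ih] at hx
    exact add_right_cancel hx
  | hr w ih => rw [← rightMul_single (R := R), hXr, hYr, ih]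
  | hr' w ih => rw [← rightMul_single (R := R), hXr', hYr', ih]

/-! ### Commutation and braid relations of the left operators -/

include h₁ h₂ in
theorem leftOp_comm (hn : 2 ≤ n) (i j : ZMod n) (hi : i - j ≠ 1) (hj : i - j ≠ -1) :
    leftOp act c i ∘ₗ leftOp act c j = leftOp act c j ∘ₗ leftOp act c i := by
  by_cases hij : i = j
  · rw [hij]
  have hs : s i ≠ s j := fun h => hij (s_injective hn h)
  have hd : ∀ {i j : ZMod n}, s i ≠ s j → ¬ IsDescent i (s j) := by
    intro i j hs
    rw [← one_mul (s j), isDescent_mul_s (by simpa using hs)]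
    exact not_isDescent_one i
  have e := s_comm i j hi hj
  refine eq_of_commute_right (act := act) (c := c) (g := fun a => act (s i) (act (s j) a))
    ?_ ?_ ?_ ?_ ?_ ?_ ?_ ?_ ?_
  · intro a v
    simp only [LinearMap.comp_apply, leftOp_smul h₂]
  · intro a v
    simp only [LinearMap.comp_apply, leftOp_smul h₂, ← AlgEquiv.mul_apply, ← map_mul act, e]
  · simp [leftOp_rightOp h₁ h₂]
  · simp [leftOp_rightOp h₁ h₂]
  · simp [leftOp_rightMul isDescent_mul_rho]
  · simp [leftOp_rightMul isDescent_mul_rho]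
  · simp [leftOp_rightMul isDescent_mul_rho_inv]
  · simp [leftOp_rightMul isDescent_mul_rho_inv]
  · simp only [LinearMap.comp_apply]
    rw [leftOp_single_one (not_isDescent_one _), leftOp_single_one (not_isDescent_one _), mul_one,
      mul_one, leftOp_single_one (hd hs), leftOp_single_one (hd hs.symm), e]

include h₁ h₂ in
theorem leftOp_braid (hn : 3 ≤ n) (i : ZMod n) :
    leftOp act c i ∘ₗ leftOp act c (i + 1) ∘ₗ leftOp act c i =
      leftOp act c (i + 1) ∘ₗ leftOp act c i ∘ₗ leftOp act c (i + 1) := by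
  have e := braid hn i
  have hs : s i ≠ s (i + 1) := fun h => s_mul_s_succ_ne hn i (by rw [h])
  have hd : ∀ {i j : ZMod n}, s i ≠ s j → ¬ IsDescent i (s j) := by
    intro i j hs
    rw [← one_mul (s j), isDescent_mul_s (by simpa using hs)]
    exact not_isDescent_one i
  have hcomm := s_mul_s_succ_ne hn i
  -- No descent occurs while the braid word is built up from `1`, so each side sends the vector at
  -- `1` to a single basis vector.
  have hd₁ : ¬ IsDescent i (s (i + 1) * s i) := by
    rw [isDescent_mul_s]
    · exact hd hs
    · exact hcomm
  have hd₂ : ¬ IsDescent (i + 1) (s i * s (i + 1)) := by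
    rw [isDescent_mul_s]
    · exact hd hs.symm
    · exact hcomm.symm
  refine eq_of_commute_right (act := act) (c := c)
    (g := fun a => act (s i) (act (s (i + 1)) (act (s i) a))) ?_ ?_ ?_ ?_ ?_ ?_ ?_ ?_ ?_
  · intro a v
    simp only [LinearMap.comp_apply, leftOp_smul h₂]
  · intro a v
    rw [mul_assoc, mul_assoc] at e
    simp only [LinearMap.comp_apply, leftOp_smul h₂, ← AlgEquiv.mul_apply, ← map_mul act, e]
  · simp [leftOp_rightOp h₁ h₂]
  · simp [leftOp_rightOp h₁ h₂]
  · simp [leftOp_rightMul isDescent_mul_rho]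
  · simp [leftOp_rightMul isDescent_mul_rho]
  · simp [leftOp_rightMul isDescent_mul_rho_inv]
  · simp [leftOp_rightMul isDescent_mul_rho_inv]
  · simp only [LinearMap.comp_apply]
    rw [leftOp_single_one (not_isDescent_one _), leftOp_single_one (not_isDescent_one _), mul_one,
      mul_one, leftOp_single_one (hd hs.symm), leftOp_single_one (hd hs),
      leftOp_single_one hd₁, leftOp_single_one hd₂, ← mul_assoc, e, mul_assoc]

end HeckeOperators

end AffineYokonuma

namespace AffineYokonuma

open ExtAffWeyl

/-! ### The finite torus and its group algebra -/

/-- The group generated by the `t_j`. -/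
abbrev Torus (r n : ℕ) : Type := ZMod n → Multiplicative (ZMod r)

namespace Torus

variable {r n : ℕ}

/-- The generator `t_j`. -/
def t (j : ZMod n) : Torus r n := Pi.mulSingle j (Multiplicative.ofAdd 1)

/-- `t_1^{β_1} ⋯ t_n^{β_n}`. -/
def tPow (β : Fin n → Fin r) : Torus r n :=
  (List.ofFn fun j : Fin n => t (((j : ℕ) + 1 : ℕ) : ZMod n) ^ (β j : ℕ)).prod

theorem t_pow (j : ZMod n) : (t j : Torus r n) ^ r = 1 := by
  rw [t, ← Pi.mulSingle_pow, ← ofAdd_nsmul]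
  simp

theorem tPow_apply (β : Fin n → Fin r) (j : Fin n) :
    tPow β (((j : ℕ) + 1 : ℕ) : ZMod n) = Multiplicative.ofAdd ((β j : ℕ) : ZMod r) := by
  rw [tPow, List.prod_ofFn, Finset.prod_apply, Finset.prod_eq_single j]
  · rw [t, ← Pi.mulSingle_pow, Pi.mulSingle_eq_same, ← ofAdd_nsmul]
    simp
  · intro k _ hk
    rw [t, ← Pi.mulSingle_pow, Pi.mulSingle_eq_of_ne]
    intro h
    -- The positions `1, …, n` are pairwise distinct modulo `n`, so only the factor with index `j`
    -- contributes to this coordinate.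
    rw [ZMod.natCast_eq_natCast_iff] at h
    have h' := Nat.ModEq.add_right_cancel' 1 h
    rw [Nat.ModEq, Nat.mod_eq_of_lt j.2, Nat.mod_eq_of_lt k.2] at h'
    exact hk (Fin.ext h'.symm)
  · simp

theorem tPow_injective : Function.Injective (tPow (r := r) (n := n)) := by
  intro β β' h
  ext j
  have := congrFun h (((j : ℕ) + 1 : ℕ) : ZMod n)
  rw [tPow_apply, tPow_apply, Multiplicative.ofAdd.apply_eq_iff_eq,
    ZMod.natCast_eq_natCast_iff] at this
  rwa [Nat.ModEq, Nat.mod_eq_of_lt (β j).2, Nat.mod_eq_of_lt (β' j).2] at this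

variable [NeZero r] [NeZero n]

theorem tPow_bijective : Function.Bijective (tPow (r := r) (n := n)) := by
  rw [Fintype.bijective_iff_injective_and_card]
  refine ⟨tPow_injective, ?_⟩
  simp [ZMod.card]

/-- The homomorphism out of a cyclic group with a given image of the generator. -/
def powHom {M : Type*} [Monoid M] (x : M) (hx : x ^ r = 1) : Multiplicative (ZMod r) →* M where
  toFun a := x ^ a.toAdd.val
  map_one' := by simp
  map_mul' a b := by
    rw [toAdd_mul, ZMod.val_add, ← pow_eq_pow_mod _ hx, pow_add]

theorem powHom_ofAdd_one {M : Type*} [Monoid M] (x : M) (hx : x ^ r = 1) :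
    powHom x hx (Multiplicative.ofAdd 1) = x := by
  change x ^ (1 : ZMod r).val = x
  rw [ZMod.val_one_eq_one_mod, ← pow_eq_pow_mod _ hx, pow_one]

omit [NeZero n] in
theorem pairwise_commute_powHom {M : Type*} [Monoid M] (x : ZMod n → M) (hx : ∀ j, x j ^ r = 1)
    (hc : ∀ i j, x i * x j = x j * x i) :
    Pairwise fun i j => ∀ a b, Commute (powHom (x i) (hx i) a) (powHom (x j) (hx j) b) :=
  fun i j _ _ _ => Commute.pow_pow (hc i j) _ _

/-- The homomorphism out of the torus with given images of the generators. -/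
noncomputable def lift {M : Type*} [Monoid M] (x : ZMod n → M) (hx : ∀ j, x j ^ r = 1)
    (hc : ∀ i j, x i * x j = x j * x i) : Torus r n →* M :=
  MonoidHom.noncommPiCoprod (fun j => powHom (x j) (hx j)) (pairwise_commute_powHom x hx hc)

section lift

variable {M : Type*} [Monoid M] {x : ZMod n → M} {hx : ∀ j, x j ^ r = 1}
  {hc : ∀ i j, x i * x j = x j * x i}

@[simp] theorem lift_t (j : ZMod n) : lift x hx hc (t j) = x j := by
  rw [lift, t, MonoidHom.noncommPiCoprod_mulSingle, powHom_ofAdd_one]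

theorem lift_tPow (β : Fin n → Fin r) : lift x hx hc (tPow β) =
    (List.ofFn fun j : Fin n => x (((j : ℕ) + 1 : ℕ) : ZMod n) ^ (β j : ℕ)).prod := by
  rw [tPow, map_list_prod, List.map_ofFn]
  congr 2
  ext1 j
  simp

end lift

theorem induction {P : Torus r n → Prop} (one : P 1) (mul : ∀ x y, P x → P y → P (x * y))
    (ht : ∀ j, P (t j)) (g : Torus r n) : P g := by
  obtain ⟨β, rfl⟩ := tPow_bijective.2 g
  rw [tPow, List.prod_ofFn]
  refine Finset.prod_induction _ P mul one fun j _ => ?_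
  generalize (β j : ℕ) = m
  induction m with
  | zero => simpa
  | succ m ih =>
    rw [pow_succ]
    exact mul _ _ ih (ht _)

omit [NeZero r] [NeZero n] in
variable (r n) in
/-- The action of the extended affine Weyl group on the torus. -/
noncomputable def weylAct : ExtAffWeyl n →* MulAut (Torus r n) :=
  mulAutArrow.comp (perm n)

omit [NeZero r] [NeZero n] in
theorem weylAct_t (w : ExtAffWeyl n) (j : ZMod n) :
    weylAct r n w (t j) = t (perm n w j) := by
  refine funext fun i => ?_
  rw [weylAct, MonoidHom.comp_apply, mulAutArrow_apply_apply]
  change t j ((perm n w)⁻¹ i) = _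
  have : (perm n w)⁻¹ i = j ↔ i = perm n w j := Equiv.Perm.inv_eq_iff_eq
  simp only [t, Pi.mulSingle_apply, this]

end Torus

/-- The group algebra of the torus. -/
abbrev TorusAlg (r n : ℕ) : Type := MonoidAlgebra (BaseRing r) (Torus r n)

/-- The sum `∑_a x^a y^{r-a}`. -/
def idemSum {B : Type*} [Semiring B] (r : ℕ) (x y : B) : B :=
  ∑ a ∈ Finset.range r, x ^ a * y ^ (r - a)

/-- Adding the term `a = r`, which equals `1`, makes the summation range symmetric under `a ↦ r -
a`, and this reflection swaps `x` and `y`. -/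
theorem idemSum_comm {B : Type*} [CommRing B] {r : ℕ} {x y : B} (hx : x ^ r = 1) (hy : y ^ r = 1) :
    idemSum r x y = idemSum r y x := by
  have key : ∀ {x y : B}, x ^ r = 1 →
      ∑ a ∈ Finset.range (r + 1), x ^ a * y ^ (r - a) = idemSum r x y + 1 := by
    intro x y hx
    rw [Finset.sum_range_succ, hx, Nat.sub_self, pow_zero, one_mul, idemSum]
  have h := Finset.sum_range_reflect (fun a => x ^ a * y ^ (r - a)) (r + 1)
  rw [key hx] at h
  rw [← add_left_inj 1, ← h, ← key hy]
  refine Finset.sum_congr rfl fun a ha => ?_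
  rw [Finset.mem_range] at ha
  rw [Nat.add_sub_cancel, mul_comm, Nat.sub_sub_self (by omega)]

/-- After adding `y`, each side is the sum of `x^a y^{r+1-a}` over `0 ≤ a ≤ r`: on the right `y` is
the last term, on the left, after a shift of the index, the first. -/
theorem idemSum_mul {B : Type*} [CommRing B] {r : ℕ} {x y : B} (hx : x ^ r = 1) (hy : y ^ r = 1) :
    idemSum r x y * x = idemSum r x y * y := by
  have h₁ : ∑ a ∈ Finset.range (r + 1), x ^ a * y ^ (r + 1 - a) = idemSum r x y * y + y := by
    rw [Finset.sum_range_succ, hx, Nat.add_sub_cancel_left, pow_one, one_mul, idemSum,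
      Finset.sum_mul]
    congr 1
    refine Finset.sum_congr rfl fun a ha => ?_
    rw [Finset.mem_range] at ha
    rw [mul_assoc, ← pow_succ, Nat.succ_sub ha.le]
  have h₂ : ∑ a ∈ Finset.range (r + 1), x ^ a * y ^ (r + 1 - a) = idemSum r x y * x + y := by
    rw [Finset.sum_range_succ', Nat.sub_zero, pow_zero, pow_succ y, hy, one_mul, one_mul, idemSum,
      Finset.sum_mul]
    congr 1
    refine Finset.sum_congr rfl fun a ha => ?_
    rw [Nat.add_sub_add_right]
    ring
  exact add_right_cancel (h₂.symm.trans h₁)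

namespace TorusAlg

variable {r n : ℕ}

/-- The generator `t_j`. -/
noncomputable def t (j : ZMod n) : TorusAlg r n := MonoidAlgebra.of (BaseRing r) _ (Torus.t j)

theorem t_pow (j : ZMod n) : (t j : TorusAlg r n) ^ r = 1 := by
  rw [t, ← map_pow, Torus.t_pow, map_one]

/-- The element `(q - q⁻¹) e_i`. -/
noncomputable def param (i : ZMod n) : TorusAlg r n :=
  qDiff r • rInv r • idemSum r (t i) (t (i + 1))

variable (r n) in
/-- The action of the extended affine Weyl group on the group algebra of the torus. -/
noncomputable def weylAct : ExtAffWeyl n →* (TorusAlg r n ≃ₐ[BaseRing r] TorusAlg r n) :=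
  MonoidAlgebra.domCongrAut.comp (Torus.weylAct r n)

theorem weylAct_of (w : ExtAffWeyl n) (g : Torus r n) :
    weylAct r n w (MonoidAlgebra.of (BaseRing r) _ g) =
      MonoidAlgebra.of (BaseRing r) _ (Torus.weylAct r n w g) := by
  simp [weylAct, MonoidAlgebra.domCongrAut, MonoidAlgebra.of_apply]

theorem weylAct_t (w : ExtAffWeyl n) (j : ZMod n) :
    weylAct r n w (t j) = t (perm n w j) := by
  rw [t, weylAct_of, Torus.weylAct_t, t]

/-- From `s_i w = w s_j` the permutation of `w` maps the pair `{j, j+1}` onto `{i, i+1}`. It may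
reverse the order, which is harmless because `e_i` is symmetric in its two arguments. -/
theorem weylAct_param (hn : 2 ≤ n) (w : ExtAffWeyl n) (i j : ZMod n) (h : s i * w = w * s j) :
    weylAct r n w (param j) = param i := by
  have hw : perm n w (j + 1) ≠ perm n w j := by
    simpa using zmod_one_ne_zero hn
  have e := congrArg (perm n) h
  rw [map_mul, map_mul, perm_s, perm_s, Equiv.mul_swap_eq_swap_mul, mul_left_inj] at e
  have e' := congrArg (fun σ : Equiv.Perm (ZMod n) => σ (perm n w j)) e
  simp only [Equiv.swap_apply_left] at e'
  have hcases : (perm n w j = i ∧ perm n w (j + 1) = i + 1) ∨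
      (perm n w j = i + 1 ∧ perm n w (j + 1) = i) := by
    rw [Equiv.swap_apply_def] at e'
    split_ifs at e' with h₁ h₂
    · exact Or.inl ⟨h₁, e'.symm⟩
    · exact Or.inr ⟨h₂, e'.symm⟩
    · exact absurd e'.symm hw
  simp only [param, map_smul, idemSum, map_sum, map_mul, map_pow, weylAct_t]
  rcases hcases with ⟨h₁, h₂⟩ | ⟨h₁, h₂⟩
  · rw [h₁, h₂]
  · rw [h₁, h₂]
    exact congrArg (fun x => qDiff r • rInv r • x) (idemSum_comm (t_pow _) (t_pow _))

theorem param_mul_t (i : ZMod n) : (param i * t i : TorusAlg r n) = param i * t (i + 1) := by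
  simp only [param, smul_mul_assoc, idemSum_mul (t_pow (r := r) i) (t_pow (i + 1))]

/-- It suffices to check the `t_j`. The action of `s_i` moves only `t_i` and `t_{i+1}`, which agree
after multiplication by `e_i`. -/
theorem param_mul_weylAct [NeZero r] [NeZero n] (i : ZMod n) (a : TorusAlg r n) :
    param i * weylAct r n (s i) a = param i * a := by
  induction a using MonoidAlgebra.induction_on with
  | of g =>
    induction g using Torus.induction with
    | one => rw [map_one, map_one]
    | mul x y hx hy =>
      rw [map_mul, map_mul, ← mul_assoc, hx, mul_right_comm, hy, mul_right_comm, mul_assoc]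
    | ht j =>
      change param i * weylAct r n (s i) (t j) = param i * t j
      rw [weylAct_t, perm_s, Equiv.swap_apply_def]
      split_ifs with h₁ h₂
      · rw [h₁, param_mul_t]
      · rw [h₂, param_mul_t]
      · rfl
  | add x y hx hy => rw [map_add, mul_add, mul_add, hx, hy]
  | smul x a ha => rw [map_smul, mul_smul_comm, mul_smul_comm, ha]

end TorusAlg

end AffineYokonuma

namespace AffineYokonuma

/-- The relation between `s_0` and the `t_j` follows from the other ones. -/
theorem s_zero_mul_t {M : Type*} [Monoid M] {n : ℕ} (hn : 2 ≤ n) (t s : ZMod n → M) (p : Mˣ)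
    (hst : ∀ i j, i ≠ 0 → s i * t j = t (Equiv.swap i (i + 1) j) * s i)
    (hps : ∀ i, p * s i = s (i - 1) * p) (hpt : ∀ j, p * t j = t (j - 1) * p) (i j : ZMod n) :
    s i * t j = t (Equiv.swap i (i + 1) j) * s i := by
  by_cases hi : i = 0
  · subst hi
    have e : Equiv.swap (1 : ZMod n) (1 + 1) (j + 1) - 1 = Equiv.swap 0 (0 + 1) j := by
      have h₁ : j + 1 = 1 ↔ j = 0 := by simp
      have h₂ : j + 1 = 1 + 1 ↔ j = 0 + 1 := by simp
      simp only [Equiv.swap_apply_def, h₁, h₂]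
      split_ifs <;> simp
    -- Since `ρ s_1 = s_0 ρ`, the relation for `s_0` is the given relation for `s_1` transported by
    -- `ρ`; `n ≥ 2` ensures that the index `1` is not `0`.
    have h : s 0 * t j * p = t (Equiv.swap 0 (0 + 1) j) * s 0 * p := by
      have hs1 := hps 1
      have htj := hpt (j + 1)
      rw [sub_self] at hs1
      rw [add_sub_cancel_right] at htj
      calc s 0 * t j * p = s 0 * p * t (j + 1) := by rw [mul_assoc, ← htj, mul_assoc]
        _ = p * (s 1 * t (j + 1)) := by rw [← hs1, mul_assoc]
        _ = p * t (Equiv.swap 1 (1 + 1) (j + 1)) * s 1 := by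
          rw [hst 1 _ (ExtAffWeyl.zmod_one_ne_zero hn), mul_assoc]
        _ = t (Equiv.swap 0 (0 + 1) j) * (p * s 1) := by rw [hpt, e, mul_assoc]
        _ = _ := by rw [hs1, mul_assoc]
    exact (Units.mul_left_inj p).1 h
  · exact hst i j hi

/-! ### The semidirect product -/

namespace YWeyl

variable {r n : ℕ}

theorem t_pow (j : ZMod n) : (t j : YWeyl r n) ^ r = 1 := by
  have := eq_of_rel (YRel.t_pow (r := r) j)
  rwa [map_pow, map_one] at this

theorem t_comm (i j : ZMod n) : (t i : YWeyl r n) * t j = t j * t i := by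
  have := eq_of_rel (YRel.t_comm (r := r) i j)
  rwa [map_mul, map_mul] at this

theorem rho_mul_t (j : ZMod n) : (rho : YWeyl r n) * t j = t (j - 1) * rho := by
  have := eq_of_rel (YRel.rho_t (r := r) j)
  rwa [map_mul, map_mul] at this

theorem rho_mul_s (j : ZMod n) : (rho : YWeyl r n) * s j = s (j - 1) * rho := by
  have := eq_of_rel (YRel.rho_s (r := r) j)
  rwa [map_mul, map_mul] at this

theorem s_mul_t (hn : 2 ≤ n) (i j : ZMod n) :
    (s i : YWeyl r n) * t j = t (Equiv.swap i (i + 1) j) * s i :=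
  s_zero_mul_t hn t s (toUnits rho) (fun i j hi => by
    have := eq_of_rel (YRel.s_t (r := r) i j hi)
    rwa [map_mul, map_mul] at this) rho_mul_s rho_mul_t i j

@[simp] theorem ofExt_s (i : ZMod n) : ofExt (ExtAffWeyl.s i) = (s i : YWeyl r n) :=
  PresentedGroup.toGroup.of _

@[simp] theorem ofExt_rho : ofExt ExtAffWeyl.rho = (rho : YWeyl r n) :=
  PresentedGroup.toGroup.of _

theorem ofExt_sWord (l : List (ZMod n)) :
    ofExt (ExtAffWeyl.sWord l) = (l.map (s : ZMod n → YWeyl r n)).prod := by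
  induction l with
  | nil => simp
  | cons i l ih => simp [ih]

/-- The projection to the semidirect product of the torus and the extended affine Weyl group. -/
noncomputable def toSemidirect (r n : ℕ) :
    YWeyl r n →* Torus r n ⋊[Torus.weylAct r n] ExtAffWeyl n :=
  PresentedGroup.toGroup (f := fun x => match x with
    | .t j => SemidirectProduct.inl (Torus.t j)
    | .s i => SemidirectProduct.inr (ExtAffWeyl.s i)
    | .rho => SemidirectProduct.inr ExtAffWeyl.rho) (by
    have key (w : ExtAffWeyl n) (j : ZMod n) :
        (SemidirectProduct.inr w * SemidirectProduct.inl (Torus.t j) :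
          Torus r n ⋊[Torus.weylAct r n] ExtAffWeyl n) =
        SemidirectProduct.inl (Torus.t (ExtAffWeyl.perm n w j)) * SemidirectProduct.inr w := by
      rw [← Torus.weylAct_t, SemidirectProduct.inl_aut]
      simp [mul_assoc]
    rintro x ⟨a, b, h, rfl⟩
    rw [map_mul, map_inv, mul_inv_eq_one]
    cases h with
    | s_sq i =>
      simp only [map_pow, map_one, FreeGroup.lift_apply_of]
      rw [← map_pow, pow_two, ExtAffWeyl.s_mul_self, map_one]
    | s_comm i j h₁ h₂ =>
      simp only [map_mul, FreeGroup.lift_apply_of]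
      rw [← map_mul, ← map_mul, ExtAffWeyl.s_comm i j h₁ h₂]
    | rho_s i =>
      simp only [map_mul, FreeGroup.lift_apply_of]
      rw [← map_mul, ← map_mul, ExtAffWeyl.rho_mul_s]
    | braid hn i =>
      simp only [map_mul, FreeGroup.lift_apply_of]
      simp only [← map_mul, ExtAffWeyl.braid hn]
    | t_pow j =>
      simp only [map_pow, map_one, FreeGroup.lift_apply_of]
      rw [← map_pow, Torus.t_pow, map_one]
    | t_comm i j =>
      simp only [map_mul, FreeGroup.lift_apply_of]
      rw [← map_mul, ← map_mul, mul_comm]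
    | s_t i j hi =>
      simp only [map_mul, FreeGroup.lift_apply_of]
      rw [key, ExtAffWeyl.perm_s]
    | rho_t j =>
      simp only [map_mul, FreeGroup.lift_apply_of]
      rw [key, ExtAffWeyl.perm_rho, Equiv.subRight_apply])

theorem toSemidirect_t (j : ZMod n) :
    toSemidirect r n (t j) = SemidirectProduct.inl (Torus.t j) :=
  PresentedGroup.toGroup.of _

theorem toSemidirect_s (i : ZMod n) :
    toSemidirect r n (s i) = SemidirectProduct.inr (ExtAffWeyl.s i) :=
  PresentedGroup.toGroup.of _

theorem toSemidirect_rho :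
    toSemidirect r n rho = SemidirectProduct.inr ExtAffWeyl.rho :=
  PresentedGroup.toGroup.of _

theorem toSemidirect_ofExt (w : ExtAffWeyl n) :
    toSemidirect r n (ofExt w) = SemidirectProduct.inr w := by
  induction w using ExtAffWeyl.induction_left with
  | one => simp
  | hs i w ih => rw [map_mul, map_mul, ih, ofExt_s, toSemidirect_s, ← map_mul]
  | hr w ih => rw [map_mul, map_mul, ih, ofExt_rho, toSemidirect_rho, ← map_mul]
  | hr' w ih =>
    rw [map_mul, map_mul, ih, map_inv, map_inv, ofExt_rho, toSemidirect_rho, ← map_inv, ← map_mul]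

theorem toSemidirect_tPow (β : Fin n → Fin r) :
    toSemidirect r n (tPow β) = SemidirectProduct.inl (Torus.tPow β) := by
  rw [tPow, Torus.tPow, map_list_prod, map_list_prod, List.map_ofFn, List.map_ofFn]
  congr 2
  ext1 j
  simp [toSemidirect_t]

/-- The two components in the semidirect product recover the torus part and the Weyl part. -/
theorem tPow_mul_ofExt_injective {β β' : Fin n → Fin r} {w w' : ExtAffWeyl n}
    (h : tPow β * ofExt w = tPow β' * ofExt w') : β = β' ∧ w = w' := by
  have e := congrArg (toSemidirect r n) h
  rw [map_mul, map_mul, toSemidirect_ofExt, toSemidirect_ofExt, toSemidirect_tPow,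
    toSemidirect_tPow] at e
  have e₁ := congrArg SemidirectProduct.left e
  have e₂ := congrArg SemidirectProduct.right e
  simp only [SemidirectProduct.mul_left, SemidirectProduct.mul_right,
    SemidirectProduct.left_inl, SemidirectProduct.left_inr, map_one, mul_one,
    SemidirectProduct.right_inl, SemidirectProduct.right_inr, one_mul] at e₁ e₂
  exact ⟨Torus.tPow_injective e₁, e₂⟩

theorem exists_eq_tPow_mul_ofExt (hr : 1 ≤ r) (hn : 2 ≤ n) (y : YWeyl r n) :
    ∃ (β : Fin n → Fin r) (w : ExtAffWeyl n), y = tPow β * ofExt w := by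
  have : NeZero r := ⟨by omega⟩
  have : NeZero n := ⟨by omega⟩
  let τ : Torus r n →* YWeyl r n := Torus.lift t t_pow t_comm
  have hs (i : ZMod n) (g : Torus r n) :
      s i * τ g = τ (Torus.weylAct r n (ExtAffWeyl.s i) g) * s i := by
    induction g using Torus.induction with
    | one => simp
    | mul x y hx hy => rw [map_mul, map_mul, map_mul, ← mul_assoc, hx, mul_assoc, hy, mul_assoc]
    | ht j => simp only [τ, Torus.weylAct_t, Torus.lift_t, ExtAffWeyl.perm_s, s_mul_t hn]
  have hrho (g : Torus r n) :
      rho * τ g = τ (Torus.weylAct r n ExtAffWeyl.rho g) * rho := by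
    induction g using Torus.induction with
    | one => simp
    | mul x y hx hy => rw [map_mul, map_mul, map_mul, ← mul_assoc, hx, mul_assoc, hy, mul_assoc]
    | ht j => simp only [τ, Torus.weylAct_t, Torus.lift_t, ExtAffWeyl.perm_rho, rho_mul_t,
        Equiv.subRight_apply]
  have hw (w : ExtAffWeyl n) (g : Torus r n) :
      ofExt w * τ g = τ (Torus.weylAct r n w g) * ofExt w := by
    induction w using ExtAffWeyl.induction_left generalizing g with
    | one => simp
    | hs i w ih =>
      rw [map_mul, mul_assoc, ih, ← mul_assoc, ofExt_s, hs, map_mul, MulAut.mul_apply, mul_assoc]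
    | hr w ih =>
      rw [map_mul, mul_assoc, ih, ← mul_assoc, ofExt_rho, hrho, map_mul, MulAut.mul_apply,
        mul_assoc]
    | hr' w ih =>
      have h := hrho (Torus.weylAct r n (ExtAffWeyl.rho⁻¹ * w) g)
      rw [← MulAut.mul_apply, ← map_mul, mul_inv_cancel_left] at h
      rw [map_mul, mul_assoc, ih, map_inv, ofExt_rho, inv_mul_eq_iff_eq_mul, ← mul_assoc,
        ← mul_assoc, h, mul_inv_cancel_right]
  -- By `hw` torus elements can be moved to the left past Weyl elements, so the products `τ g *
  -- ofExt w` are closed under multiplication and inversion; they contain all generators.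
  suffices h : ∃ (g : Torus r n) (w : ExtAffWeyl n), y = τ g * ofExt w by
    obtain ⟨g, w, rfl⟩ := h
    obtain ⟨β, rfl⟩ := Torus.tPow_bijective.2 g
    exact ⟨β, w, by rw [Torus.lift_tPow, tPow]⟩
  have hτ (j : ZMod n) : t j = τ (Torus.t j) * ofExt 1 := by
    simp only [τ, Torus.lift_t, map_one, mul_one]
  have hgen (x : YGen n) : ∃ (g : Torus r n) (w : ExtAffWeyl n),
      (PresentedGroup.of x : YWeyl r n) = τ g * ofExt w := by
    rcases x with j | i | _
    · exact ⟨_, _, hτ j⟩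
    · exact ⟨1, ExtAffWeyl.s i, by rw [map_one, one_mul, ofExt_s, s]⟩
    · exact ⟨1, ExtAffWeyl.rho, by rw [map_one, one_mul, ofExt_rho, rho]⟩
  have hy : y ∈ Subgroup.closure (Set.range PresentedGroup.of) := by
    rw [PresentedGroup.closure_range_of]
    trivial
  induction hy using Subgroup.closure_induction with
  | mem x hx =>
    obtain ⟨x, rfl⟩ := hx
    exact hgen x
  | one => exact ⟨1, 1, by simp⟩
  | mul x y _ _ hx hy =>
    obtain ⟨g, w, rfl⟩ := hx
    obtain ⟨g', w', rfl⟩ := hy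
    refine ⟨g * Torus.weylAct r n w g', w * w', ?_⟩
    rw [map_mul, map_mul, mul_assoc, ← mul_assoc (ofExt w), hw]
    simp only [mul_assoc]
  | inv x _ hx =>
    obtain ⟨g, w, rfl⟩ := hx
    refine ⟨Torus.weylAct r n w⁻¹ g⁻¹, w⁻¹, ?_⟩
    rw [← hw, mul_inv_rev, map_inv, map_inv]

end YWeyl

end AffineYokonuma

namespace AffineYokonuma

namespace HAff

variable {r n : ℕ}

/-! ### Relations in the algebra -/

theorem t_pow (j : ZMod n) : (t j : HAff r n) ^ r = 1 := by
  rw [t, ← map_pow, mk_eq_of_rel (HRel.t_pow j), map_one]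

theorem t_comm (i j : ZMod n) : (t i : HAff r n) * t j = t j * t i := by
  rw [t, t, ← map_mul, mk_eq_of_rel (HRel.t_comm i j), map_mul]

theorem Trho_mul_t (j : ZMod n) : ((Trho : (HAff r n)ˣ) : HAff r n) * t j = t (j - 1) * ((Trho : (HAff r n)ˣ) : HAff r n) := by
  simp only [Trho, t]
  rw [← map_mul, mk_eq_of_rel (HRel.rho_t j), map_mul]

theorem Trho_mul_Ts (i : ZMod n) : ((Trho : (HAff r n)ˣ) : HAff r n) * Ts i = Ts (i - 1) * ((Trho : (HAff r n)ˣ) : HAff r n) := by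
  simp only [Trho, Ts]
  rw [← map_mul, mk_eq_of_rel (HRel.rho_s i), map_mul]

theorem Ts_mul_t (hn : 2 ≤ n) (i j : ZMod n) :
    (Ts i : HAff r n) * t j = t (Equiv.swap i (i + 1) j) * Ts i :=
  s_zero_mul_t hn t Ts Trho (fun i j hi => by
    simp only [t, Ts]
    rw [← map_mul, mk_eq_of_rel (HRel.s_t i j hi), map_mul]) Trho_mul_Ts Trho_mul_t i j

theorem Ts_comm (i j : ZMod n) (h₁ : i - j ≠ 1) (h₂ : i - j ≠ -1) :
    (Ts i : HAff r n) * Ts j = Ts j * Ts i := by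
  rw [Ts, Ts, ← map_mul, mk_eq_of_rel (HRel.s_comm i j h₁ h₂), map_mul]

theorem Ts_braid (hn : 3 ≤ n) (i : ZMod n) :
    (Ts i : HAff r n) * Ts (i + 1) * Ts i = Ts (i + 1) * Ts i * Ts (i + 1) := by
  rw [Ts, Ts, ← map_mul, ← map_mul, mk_eq_of_rel (HRel.braid hn i), map_mul, map_mul]

theorem mk_gen_t (j : ZMod n) : mk r n (gen r (.t j)) = t j := rfl

theorem mk_gen_s (i : ZMod n) : mk r n (gen r (.s i)) = Ts i := rfl

theorem mk_gen_rho : mk r n (gen r .rho) = ((Trho : (HAff r n)ˣ) : HAff r n) := rfl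

theorem mk_gen_rhoInv : mk r n (gen r .rhoInv) = ((Trho⁻¹ : (HAff r n)ˣ) : HAff r n) := rfl

variable [NeZero r] [NeZero n]

variable (r n) in
/-- The homomorphism from the group algebra of the torus. -/
noncomputable def ofTorus : TorusAlg r n →ₐ[BaseRing r] HAff r n :=
  MonoidAlgebra.lift (BaseRing r) (HAff r n) (Torus r n) (Torus.lift t t_pow t_comm)

theorem ofTorus_of (g : Torus r n) :
    ofTorus r n (MonoidAlgebra.of (BaseRing r) _ g) = Torus.lift t t_pow t_comm g := by
  rw [ofTorus, MonoidAlgebra.lift_of]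

@[simp] theorem ofTorus_t (j : ZMod n) : ofTorus r n (TorusAlg.t j) = t j := by
  rw [TorusAlg.t, ofTorus_of, Torus.lift_t]

theorem ofTorus_tPow (β : Fin n → Fin r) :
    ofTorus r n (MonoidAlgebra.of (BaseRing r) _ (Torus.tPow β)) = tPow β := by
  rw [ofTorus_of, Torus.lift_tPow, tPow]

theorem mul_ofTorus {x : HAff r n} {w : ExtAffWeyl n}
    (h : ∀ j, x * t j = t (ExtAffWeyl.perm n w j) * x) (a : TorusAlg r n) :
    x * ofTorus r n a = ofTorus r n (TorusAlg.weylAct r n w a) * x := by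
  induction a using MonoidAlgebra.induction_on with
  | of g =>
    induction g using Torus.induction with
    | one => simp only [map_one, mul_one, one_mul]
    | mul g g' hg hg' =>
      rw [map_mul, map_mul, map_mul, map_mul, ← mul_assoc, hg, mul_assoc, hg', mul_assoc]
    | ht j =>
      change x * ofTorus r n (TorusAlg.t j) =
        ofTorus r n (TorusAlg.weylAct r n w (TorusAlg.t j)) * x
      rw [TorusAlg.weylAct_t, ofTorus_t, ofTorus_t, h]
  | add a b ha hb => simp only [map_add, mul_add, add_mul, ha, hb]
  | smul c a ha => simp only [map_smul, mul_smul_comm, smul_mul_assoc, ha]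

theorem Ts_mul_ofTorus (hn : 2 ≤ n) (i : ZMod n) (a : TorusAlg r n) :
    Ts i * ofTorus r n a = ofTorus r n (TorusAlg.weylAct r n (ExtAffWeyl.s i) a) * Ts i :=
  mul_ofTorus (fun j => by rw [Ts_mul_t hn, ExtAffWeyl.perm_s]) a

theorem Trho_mul_ofTorus (a : TorusAlg r n) :
    ((Trho : (HAff r n)ˣ) : HAff r n) * ofTorus r n a =
      ofTorus r n (TorusAlg.weylAct r n ExtAffWeyl.rho a) *
        ((Trho : (HAff r n)ˣ) : HAff r n) :=
  mul_ofTorus (fun j => by rw [Trho_mul_t, ExtAffWeyl.perm_rho, Equiv.subRight_apply]) a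

theorem Trho_inv_mul_ofTorus (a : TorusAlg r n) :
    ((Trho⁻¹ : (HAff r n)ˣ) : HAff r n) * ofTorus r n a =
      ofTorus r n (TorusAlg.weylAct r n ExtAffWeyl.rho⁻¹ a) * (Trho⁻¹ : (HAff r n)ˣ) := by
  rw [Units.inv_mul_eq_iff_eq_mul, ← mul_assoc, Trho_mul_ofTorus, ← AlgEquiv.mul_apply, ← map_mul,
    mul_inv_cancel, map_one, AlgEquiv.one_apply, Units.mul_inv_cancel_right]

theorem ofTorus_param (i : ZMod n) :
    ofTorus r n (TorusAlg.param i) = qDiff r • mk r n (idem r i) := by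
  simp only [TorusAlg.param, idem, idemSum, map_smul, map_sum, map_mul, map_pow, ofTorus_t, t]

theorem Ts_mul_Ts (i : ZMod n) :
    (Ts i : HAff r n) * Ts i = 1 + ofTorus r n (TorusAlg.param i) * Ts i := by
  rw [Ts, ← pow_two, ← map_pow, mk_eq_of_rel (HRel.quad i), map_add, map_one, map_smul, map_mul,
    ofTorus_param, smul_mul_assoc]

omit [NeZero r] [NeZero n] in
theorem Ts_mul_Trho_zpow (i : ZMod n) (k : ℤ) :
    Ts i * ((Trho ^ k : (HAff r n)ˣ) : HAff r n) = ((Trho ^ k : (HAff r n)ˣ) : HAff r n) *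
      Ts (i + (k : ZMod n)) := by
  induction k using Int.induction_on with
  | zero => simp
  | succ k ih =>
    have h := Trho_mul_Ts (r := r) (i + ((k : ℤ) : ZMod n) + 1)
    rw [add_sub_cancel_right] at h
    rw [zpow_add_one, Units.val_mul, ← mul_assoc, ih, mul_assoc, ← h, ← mul_assoc]
    push_cast
    rw [add_assoc]
  | pred k ih =>
    have h := Trho_mul_Ts (r := r) (i + ((-k : ℤ) : ZMod n))
    have h' : Ts (i + ((-k : ℤ) : ZMod n)) * ((Trho⁻¹ : (HAff r n)ˣ) : HAff r n) =
        ((Trho⁻¹ : (HAff r n)ˣ) : HAff r n) * Ts (i + ((-k : ℤ) : ZMod n) - 1) := by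
      rw [Units.mul_inv_eq_iff_eq_mul, mul_assoc, ← h, Units.inv_mul_cancel_left]
    rw [zpow_sub_one, Units.val_mul, ← mul_assoc, ih, mul_assoc, h', ← mul_assoc]
    push_cast
    rw [add_sub_assoc]

/-! ### The standard elements of the extended affine Weyl group -/

open ExtAffWeyl (sWord IsDescent)

omit [NeZero r] [NeZero n] in
theorem exists_reduced_expr (w : ExtAffWeyl n) : ∃ e : ℤ × List (ZMod n),
    w = ExtAffWeyl.rho ^ e.1 * sWord e.2 ∧ ExtAffWeyl.IsReduced e.2 := by
  obtain ⟨k, l, rfl⟩ := ExtAffWeyl.exists_eq_rho_zpow_mul_sWord w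
  obtain ⟨l', h, hl'⟩ := ExtAffWeyl.exists_isReduced l
  exact ⟨(k, l'), by rw [h], hl'⟩

variable (r) in
/-- The element `T_w` for `w` in the extended affine Weyl group. -/
noncomputable def weylElt (w : ExtAffWeyl n) : HAff r n :=
  ((Trho ^ (exists_reduced_expr w).choose.1 : (HAff r n)ˣ) : HAff r n) *
    ((exists_reduced_expr w).choose.2.map Ts).prod

omit [NeZero r] [NeZero n] in
-- The `ρ`-exponent and the affine part are determined by the element, and the word property removes
-- the dependence on the chosen reduced word.
theorem weylElt_eq (hn : 2 ≤ n) (k : ℤ) {l : List (ZMod n)} (h : ExtAffWeyl.IsReduced l) :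
    weylElt r (ExtAffWeyl.rho ^ k * sWord l) =
      ((Trho ^ k : (HAff r n)ˣ) : HAff r n) * (l.map Ts).prod := by
  obtain ⟨h₁, h₂⟩ := (exists_reduced_expr (ExtAffWeyl.rho ^ k * sWord l)).choose_spec
  obtain ⟨hk, hl⟩ := ExtAffWeyl.rho_zpow_mul_sWord_inj h₁
  rw [weylElt, ← hk, h.prod_map_eq hn Ts_comm Ts_braid h₂ hl]

omit [NeZero r] [NeZero n] in
theorem weylElt_one (hn : 2 ≤ n) : weylElt r (1 : ExtAffWeyl n) = 1 := by
  have h : ExtAffWeyl.IsReduced ([] : List (ZMod n)) := ExtAffWeyl.isReduced_iff.2 fun _ _ => Nat.zero_le _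
  simpa using weylElt_eq (r := r) hn 0 h

omit [NeZero r] [NeZero n] in
theorem weylElt_rho_mul (hn : 2 ≤ n) (w : ExtAffWeyl n) :
    weylElt r (ExtAffWeyl.rho * w) = ((Trho : (HAff r n)ˣ) : HAff r n) * weylElt r w := by
  obtain ⟨⟨k, l⟩, rfl, hl⟩ := exists_reduced_expr w
  rw [← mul_assoc, ← zpow_one_add, weylElt_eq hn _ hl, weylElt_eq hn _ hl, zpow_one_add,
    Units.val_mul, mul_assoc]

omit [NeZero r] [NeZero n] in
theorem weylElt_rho_inv_mul (hn : 2 ≤ n) (w : ExtAffWeyl n) :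
    weylElt r (ExtAffWeyl.rho⁻¹ * w) = ((Trho⁻¹ : (HAff r n)ˣ) : HAff r n) * weylElt r w := by
  rw [Units.eq_inv_mul_iff_mul_eq, ← weylElt_rho_mul hn, mul_inv_cancel_left]

omit [NeZero r] [NeZero n] in
theorem isDescent_rho_zpow_mul (i : ZMod n) (k : ℤ) (w : ExtAffWeyl n) :
    IsDescent i (ExtAffWeyl.rho ^ k * w) ↔ IsDescent (i + (k : ZMod n)) w := by
  have h : ExtAffWeyl.inversion (ExtAffWeyl.rho ^ k)⁻¹ (ExtAffWeyl.s i) = 0 := by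
    rw [← zpow_neg]
    generalize ExtAffWeyl.s i = x
    generalize -k = m
    induction m using Int.induction_on generalizing x with
    | zero => simp
    | succ m ih => rw [zpow_add_one, ExtAffWeyl.inversion_mul, ih]; simp
    | pred m ih => rw [zpow_sub_one, ExtAffWeyl.inversion_mul, ih]; simp
  rw [IsDescent, mul_inv_rev, ExtAffWeyl.inversion_mul, h, zero_add, inv_inv, mul_assoc,
    ExtAffWeyl.s_mul_rho_zpow, inv_mul_cancel_left, IsDescent]

omit [NeZero r] [NeZero n] in
theorem weylElt_s_mul (hn : 2 ≤ n) {i : ZMod n} {w : ExtAffWeyl n} (h : ¬ IsDescent i w) :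
    weylElt r (ExtAffWeyl.s i * w) = Ts i * weylElt r w := by
  obtain ⟨⟨k, l⟩, rfl, hl⟩ := exists_reduced_expr w
  rw [isDescent_rho_zpow_mul] at h
  rw [← mul_assoc, ExtAffWeyl.s_mul_rho_zpow, mul_assoc, ← ExtAffWeyl.sWord_cons,
    weylElt_eq hn _ (hl.cons h), weylElt_eq hn _ hl, ← mul_assoc, Ts_mul_Trho_zpow, List.map_cons,
    List.prod_cons, mul_assoc]

/-- In the descent case `T_w = T_{s_i} T_{s_i w}`, and the quadratic relation gives the second term.
This formula is the model for `leftOp`. -/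
theorem Ts_mul_weylElt (hn : 2 ≤ n) (i : ZMod n) (w : ExtAffWeyl n) :
    Ts i * weylElt r w = weylElt r (ExtAffWeyl.s i * w) +
      ofTorus r n (descentCoeff TorusAlg.param i w) * weylElt r w := by
  by_cases h : IsDescent i w
  · have h' : ¬ IsDescent i (ExtAffWeyl.s i * w) := by
      rwa [ExtAffWeyl.isDescent_s_mul, not_not]
    have e := weylElt_s_mul (r := r) hn h'
    rw [ExtAffWeyl.s_mul_s_mul] at e
    rw [e, descentCoeff_of h, ← mul_assoc, Ts_mul_Ts, add_mul, one_mul, mul_assoc]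
  · rw [weylElt_s_mul hn h, descentCoeff_of_not h, map_zero, zero_mul, add_zero]

/-! ### The representation on the free module -/

/-- The free module with basis `t^β T_w`. -/
abbrev StdModule (r n : ℕ) : Type := ExtAffWeyl n →₀ TorusAlg r n

variable (r n) in
/-- The images of the generators. -/
noncomputable def genAction : HGen n → Module.End (BaseRing r) (StdModule r n)
  | .t j => Algebra.lsmul (BaseRing r) (BaseRing r) (StdModule r n)
    (TorusAlg.t j : TorusAlg r n)
  | .s i => leftOp (TorusAlg.weylAct r n) TorusAlg.param i
  | .rho => leftMul (TorusAlg.weylAct r n) ExtAffWeyl.rho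
  | .rhoInv => leftMul (TorusAlg.weylAct r n) ExtAffWeyl.rho⁻¹

omit [NeZero r] [NeZero n] in
theorem genAction_t_apply (j : ZMod n) (v : StdModule r n) :
    genAction r n (.t j) v = (TorusAlg.t j : TorusAlg r n) • v := rfl

theorem genAction_rel (hn : 2 ≤ n) {x y : FreeAlgebra (BaseRing r) (HGen n)} (h : HRel r n x y) :
    FreeAlgebra.lift (BaseRing r) (genAction r n) x =
      FreeAlgebra.lift (BaseRing r) (genAction r n) y := by
  have h₁ := TorusAlg.weylAct_param (r := r) hn
  have h₂ := TorusAlg.param_mul_weylAct (r := r) (n := n)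
  cases h with
  | t_pow j =>
    simp only [gen, map_pow, FreeAlgebra.lift_ι_apply, genAction, map_one]
    rw [← map_pow, TorusAlg.t_pow, map_one]
  | t_comm i j =>
    simp only [gen, map_mul, FreeAlgebra.lift_ι_apply, genAction]
    rw [← map_mul, ← map_mul, mul_comm]
  | s_t i j _ =>
    simp only [gen, map_mul, FreeAlgebra.lift_ι_apply, genAction]
    refine LinearMap.ext fun v => ?_
    simp only [Module.End.mul_apply, Algebra.lsmul_coe]
    rw [leftOp_smul h₂, TorusAlg.weylAct_t, ExtAffWeyl.perm_s]
  | rho_t j =>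
    simp only [gen, map_mul, FreeAlgebra.lift_ι_apply, genAction]
    refine LinearMap.ext fun v => ?_
    simp only [Module.End.mul_apply, Algebra.lsmul_coe]
    rw [leftMul_smul, TorusAlg.weylAct_t, ExtAffWeyl.perm_rho, Equiv.subRight_apply]
  | rho_s i =>
    simp only [gen, map_mul, FreeAlgebra.lift_ι_apply, genAction]
    exact LinearMap.ext fun v => leftMul_rho_leftOp h₁ i v
  | s_comm i j hi hj =>
    simp only [gen, map_mul, FreeAlgebra.lift_ι_apply, genAction]
    exact leftOp_comm h₁ h₂ hn i j hi hj
  | braid hn3 i =>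
    simp only [gen, map_mul, FreeAlgebra.lift_ι_apply, genAction, mul_assoc]
    exact leftOp_braid h₁ h₂ hn3 i
  | quad i =>
    have e : FreeAlgebra.lift (BaseRing r) (genAction r n) (qDiff r • idem r i) =
        Algebra.lsmul (BaseRing r) (BaseRing r) (StdModule r n)
          (TorusAlg.param i : TorusAlg r n) := by
      simp only [TorusAlg.param, idem, idemSum, gen, map_smul, map_sum, map_mul, map_pow,
        FreeAlgebra.lift_ι_apply, genAction]
    rw [← smul_mul_assoc, map_add, map_mul, e]
    simp only [gen, map_pow, FreeAlgebra.lift_ι_apply, genAction, map_one]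
    exact LinearMap.ext fun v => leftOp_leftOp_self h₁ i v
  | rho_rhoInv =>
    simp only [gen, map_mul, FreeAlgebra.lift_ι_apply, genAction, map_one]
    refine LinearMap.ext fun v => ?_
    rw [Module.End.mul_apply, leftMul_mul, mul_inv_cancel, leftMul_one, Module.End.one_apply]
  | rhoInv_rho =>
    simp only [gen, map_mul, FreeAlgebra.lift_ι_apply, genAction, map_one]
    refine LinearMap.ext fun v => ?_
    rw [Module.End.mul_apply, leftMul_mul, inv_mul_cancel, leftMul_one, Module.End.one_apply]

/-- The action of the algebra on the free module. -/
noncomputable def action (hn : 2 ≤ n) :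
    HAff r n →ₐ[BaseRing r] Module.End (BaseRing r) (StdModule r n) :=
  RingQuot.liftAlgHom (BaseRing r)
    ⟨FreeAlgebra.lift (BaseRing r) (genAction r n), fun _ _ h => genAction_rel hn h⟩

theorem action_mk (hn : 2 ≤ n) (x : FreeAlgebra (BaseRing r) (HGen n)) :
    action hn (mk r n x) = FreeAlgebra.lift (BaseRing r) (genAction r n) x :=
  RingQuot.liftAlgHom_mkAlgHom_apply _ _ _ _

theorem action_gen (hn : 2 ≤ n) (x : HGen n) :
    action hn (mk r n (gen r x)) = genAction r n x := by
  rw [action_mk, gen, FreeAlgebra.lift_ι_apply]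

variable (r n) in
/-- The linear map from the free module to the algebra, `a T_w ↦ a T_w`. -/
noncomputable def fromStd : StdModule r n →ₗ[BaseRing r] HAff r n :=
  Finsupp.lsum (BaseRing r) fun w =>
    LinearMap.mulRight (BaseRing r) (weylElt r w) ∘ₗ (ofTorus r n).toLinearMap

theorem fromStd_single (w : ExtAffWeyl n) (a : TorusAlg r n) :
    fromStd r n (Finsupp.single w a) = ofTorus r n a * weylElt r w := by
  simp [fromStd]

theorem mul_fromStd_gen (hn : 2 ≤ n) (x : HGen n) (v : StdModule r n) :
    mk r n (gen r x) * fromStd r n v = fromStd r n (genAction r n x v) := by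
  induction v using Finsupp.induction_linear with
  | zero => simp only [map_zero, mul_zero]
  | add v w hv hw => simp only [map_add, mul_add, hv, hw]
  | single w a =>
    rw [fromStd_single]
    cases x with
    | t j =>
      rw [mk_gen_t, genAction_t_apply, Finsupp.smul_single, smul_eq_mul, fromStd_single, map_mul, ofTorus_t,
        mul_assoc]
    | s i =>
      rw [genAction, leftOp_single, map_add, fromStd_single, fromStd_single]
      -- Moving `T_{s_i}` past `a` twists `a` by `s_i`; the descent coefficient absorbs this twist,
      -- as in the definition of `leftOp`.
      rw [mk_gen_s, ← mul_assoc, Ts_mul_ofTorus hn, mul_assoc, Ts_mul_weylElt hn, mul_add, ← mul_assoc,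
        ← map_mul, mul_comm _ (descentCoeff _ _ _), descentCoeff_mul_act TorusAlg.param_mul_weylAct]
    | rho =>
      rw [genAction, leftMul_single, fromStd_single]
      rw [mk_gen_rho, ← mul_assoc, Trho_mul_ofTorus, mul_assoc, weylElt_rho_mul hn]
    | rhoInv =>
      rw [genAction, leftMul_single, fromStd_single]
      rw [mk_gen_rhoInv, ← mul_assoc, Trho_inv_mul_ofTorus, mul_assoc, weylElt_rho_inv_mul hn]

theorem mul_fromStd (hn : 2 ≤ n) (h : HAff r n) (v : StdModule r n) :
    h * fromStd r n v = fromStd r n (action hn h v) := by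
  obtain ⟨x, rfl⟩ := RingQuot.mkAlgHom_surjective (BaseRing r) (HRel r n) h
  change mk r n x * fromStd r n v = fromStd r n (action hn (mk r n x) v)
  induction x using FreeAlgebra.induction generalizing v with
  | grade0 c =>
    rw [AlgHom.commutes, AlgHom.commutes, Module.algebraMap_end_apply, map_smul, Algebra.smul_def]
  | grade1 x =>
    have := action_gen (r := r) hn x
    rw [gen] at this
    rw [this]
    exact mul_fromStd_gen hn x v
  | mul x y hx hy => rw [map_mul, mul_assoc, hy, hx, map_mul, Module.End.mul_apply]
  | add x y hx hy => rw [map_add, add_mul, hx, hy, map_add, LinearMap.add_apply, map_add]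

/-- By equivariance the left side is `h` times the image of the vector at `1`, which is the unit.
This is the spanning statement. -/
theorem fromStd_action (hn : 2 ≤ n) (h : HAff r n) :
    fromStd r n (action hn h (Finsupp.single 1 1)) = h := by
  rw [← mul_fromStd, fromStd_single, map_one, weylElt_one hn, mul_one, mul_one]

theorem action_ofTorus (hn : 2 ≤ n) (a : TorusAlg r n) (v : StdModule r n) :
    action hn (ofTorus r n a) v = a • v := by
  induction a using MonoidAlgebra.induction_on generalizing v with
  | of g =>
    induction g using Torus.induction generalizing v with
    | one => rw [map_one, map_one, map_one, Module.End.one_apply, one_smul]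
    | mul g g' hg hg' => rw [map_mul, map_mul, map_mul, Module.End.mul_apply, hg', hg, mul_smul]
    | ht j =>
      change action hn (ofTorus r n (TorusAlg.t j)) v = TorusAlg.t j • v
      rw [ofTorus_t, t, action_gen]
      rfl
  | add a b ha hb => rw [map_add, map_add, LinearMap.add_apply, ha, hb, add_smul]
  | smul c a ha => rw [map_smul, map_smul, LinearMap.smul_apply, ha, smul_assoc]

theorem action_Trho_zpow (hn : 2 ≤ n) (k : ℤ) (v : StdModule r n) :
    action hn ((Trho ^ k : (HAff r n)ˣ) : HAff r n) v =
      leftMul (TorusAlg.weylAct r n) (ExtAffWeyl.rho ^ k) v := by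
  induction k using Int.induction_on generalizing v with
  | zero => rw [zpow_zero, zpow_zero, Units.val_one, map_one, leftMul_one, Module.End.one_apply]
  | succ k ih =>
    rw [zpow_add_one, zpow_add_one, Units.val_mul, map_mul, Module.End.mul_apply, ih, ← leftMul_mul]
    congr 1
    exact LinearMap.congr_fun (action_gen hn HGen.rho) v
  | pred k ih =>
    rw [zpow_sub_one, zpow_sub_one, Units.val_mul, map_mul, Module.End.mul_apply, ih, ← leftMul_mul]
    congr 1
    exact LinearMap.congr_fun (action_gen hn HGen.rhoInv) v

theorem action_prod_Ts (hn : 2 ≤ n) {l : List (ZMod n)} (h : ExtAffWeyl.IsReduced l) :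
    action hn (l.map Ts).prod (Finsupp.single 1 1 : StdModule r n) =
      Finsupp.single (sWord l) 1 := by
  induction l with
  | nil => simp
  | cons i l ih =>
    rw [List.map_cons, List.prod_cons, map_mul, Module.End.mul_apply, ih h.tail, Ts, action_gen,
      genAction, leftOp_single_one h.not_isDescent, ExtAffWeyl.sWord_cons]

theorem action_weylElt (hn : 2 ≤ n) (w : ExtAffWeyl n) :
    action hn (weylElt r w) (Finsupp.single 1 1) = Finsupp.single w 1 := by
  obtain ⟨⟨k, l⟩, rfl, hl⟩ := exists_reduced_expr w
  rw [weylElt_eq hn k hl, map_mul, Module.End.mul_apply, action_prod_Ts hn hl, action_Trho_zpow,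
    leftMul_single, map_one]

/-- Linear independence: `T_w` sends the vector at `1` to the vector at `w`, and the torus algebra
acts by scalars. -/
theorem action_fromStd (hn : 2 ≤ n) (v : StdModule r n) :
    action hn (fromStd r n v) (Finsupp.single 1 1) = v := by
  induction v using Finsupp.induction_linear with
  | zero => simp
  | add v w hv hw => rw [map_add, map_add, LinearMap.add_apply, hv, hw]
  | single w a =>
    rw [fromStd_single, map_mul, Module.End.mul_apply, action_weylElt, action_ofTorus,
      Finsupp.smul_single, smul_eq_mul, mul_one]

variable (r) in
/-- The algebra is isomorphic to the free module. -/
noncomputable def stdEquiv (hn : 2 ≤ n) : StdModule r n ≃ₗ[BaseRing r] HAff r n :=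
  { fromStd r n with
    invFun := fun h => action hn h (Finsupp.single 1 1)
    left_inv := action_fromStd hn
    right_inv := fromStd_action hn }

variable (r n) in
/-- The indices of the basis of the free module. -/
noncomputable def pairEquiv : (Σ _ : ExtAffWeyl n, Torus r n) ≃ (Fin n → Fin r) × ExtAffWeyl n :=
  (Equiv.sigmaEquivProd _ _).trans ((Equiv.prodComm _ _).trans
    ((Equiv.ofBijective _ Torus.tPow_bijective).symm.prodCongr (Equiv.refl _)))

theorem pairEquiv_symm_apply (β : Fin n → Fin r) (w : ExtAffWeyl n) :
    (pairEquiv r n).symm (β, w) = ⟨w, Torus.tPow β⟩ := rfl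

variable (r) in
/-- The basis `t^β T_w` indexed by pairs. -/
noncomputable def pairBasis (hn : 2 ≤ n) :
    Module.Basis ((Fin n → Fin r) × ExtAffWeyl n) (BaseRing r) (HAff r n) :=
  ((Finsupp.basis fun _ : ExtAffWeyl n => MonoidAlgebra.basis (Torus r n) (BaseRing r)).map
    (stdEquiv r hn)).reindex (pairEquiv r n)

theorem stdEquiv_apply (hn : 2 ≤ n) (v : StdModule r n) : stdEquiv r hn v = fromStd r n v := rfl

theorem pairBasis_apply (hn : 2 ≤ n) (β : Fin n → Fin r) (w : ExtAffWeyl n) :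
    pairBasis r hn (β, w) = tPow β * weylElt r w := by
  rw [pairBasis, Module.Basis.reindex_apply, Module.Basis.map_apply, pairEquiv_symm_apply,
    Finsupp.coe_basis]
  dsimp only
  rw [MonoidAlgebra.basis_apply, stdEquiv_apply, fromStd_single, ← ofTorus_tPow,
    MonoidAlgebra.of_apply]

/-! ### The standard basis -/

omit [NeZero r] [NeZero n] in
theorem ofExpr_eq (hn : 2 ≤ n) (β : Fin n → Fin r) (k : ℤ) {l : List (ZMod n)}
    (h : ExtAffWeyl.IsReduced l) :
    ofExpr β k l = tPow β * weylElt r (ExtAffWeyl.rho ^ k * sWord l) := by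
  rw [ofExpr, weylElt_eq hn k h, mul_assoc]

omit [NeZero r] [NeZero n] in
theorem isReducedExpr_iff {y : YWeyl r n} {β : Fin n → Fin r} {k : ℤ} {l : List (ZMod n)} :
    YWeyl.IsReducedExpr y β k l ↔
      y = YWeyl.tPow β * YWeyl.ofExt (ExtAffWeyl.rho ^ k * sWord l) ∧ ExtAffWeyl.IsReduced l := by
  rw [YWeyl.IsReducedExpr, map_mul, map_zpow, YWeyl.ofExt_rho, YWeyl.ofExt_sWord, ← mul_assoc,
    ExtAffWeyl.IsReduced]

omit [NeZero r] [NeZero n] in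
-- Whatever reduced expression is chosen for `T`, uniqueness of the normal form gives it the same
-- `β` and the same Weyl element.
theorem T_tPow_mul_ofExt (hn : 2 ≤ n) (β : Fin n → Fin r) (w : ExtAffWeyl n) :
    T (YWeyl.tPow β * YWeyl.ofExt w) = tPow β * weylElt r w := by
  obtain ⟨⟨k, l⟩, hw, hl⟩ := exists_reduced_expr w
  have h : ∃ e : (Fin n → Fin r) × ℤ × List (ZMod n),
      YWeyl.IsReducedExpr (YWeyl.tPow β * YWeyl.ofExt w) e.1 e.2.1 e.2.2 :=
    ⟨(β, k, l), isReducedExpr_iff.2 ⟨by rw [hw], hl⟩⟩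
  obtain ⟨e, he⟩ := isReducedExpr_iff.1 h.choose_spec
  obtain ⟨h₁, h₂⟩ := YWeyl.tPow_mul_ofExt_injective e
  rw [T, dif_pos h, ofExpr_eq hn _ _ he, ← h₁, ← h₂]

omit [NeZero n] in
theorem T_ofExt (hn : 2 ≤ n) (w : ExtAffWeyl n) :
    T (YWeyl.ofExt w : YWeyl r n) = weylElt r w := by
  have h := T_tPow_mul_ofExt (r := r) hn 0 w
  have h₁ : YWeyl.tPow (0 : Fin n → Fin r) = (1 : YWeyl r n) := by
    rw [YWeyl.tPow, List.prod_eq_one]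
    simp
  have h₂ : tPow (0 : Fin n → Fin r) = (1 : HAff r n) := by
    rw [tPow, List.prod_eq_one]
    simp
  rwa [h₁, h₂, one_mul, one_mul] at h

end HAff

/-! ### Comparison of the two index sets, and conclusion -/

theorem YWeyl.tPow_mul_ofExt_bijective {r n : ℕ} (hr : 1 ≤ r) (hn : 2 ≤ n) :
    Function.Bijective fun p : (Fin n → Fin r) × ExtAffWeyl n => tPow p.1 * ofExt p.2 :=
  ⟨fun _ _ h => Prod.ext (tPow_mul_ofExt_injective h).1 (tPow_mul_ofExt_injective h).2,
    fun y => by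
      obtain ⟨β, w, rfl⟩ := exists_eq_tPow_mul_ofExt hr hn y
      exact ⟨(β, w), rfl⟩⟩

end AffineYokonuma

theorem proposition2p7 (r n : ℕ) (hr : 1 ≤ r) (hn : 2 ≤ n) :
    (∀ (w : AffineYokonuma.YWeyl r n) (β : Fin n → Fin r) (k : ℤ) (l : List (ZMod n)),
      AffineYokonuma.YWeyl.IsReducedExpr w β k l →
        AffineYokonuma.HAff.T w = AffineYokonuma.HAff.ofExpr β k l) ∧
    (∃ b : Module.Basis (AffineYokonuma.YWeyl r n) (AffineYokonuma.BaseRing r)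
        (AffineYokonuma.HAff r n),
      ∀ w, b w = AffineYokonuma.HAff.T w) ∧
    (∃ b : Module.Basis ((Fin n → Fin r) × AffineYokonuma.ExtAffWeyl n)
        (AffineYokonuma.BaseRing r) (AffineYokonuma.HAff r n),
      ∀ (β : Fin n → Fin r) (w : AffineYokonuma.ExtAffWeyl n),
        b (β, w) = AffineYokonuma.HAff.tPow β *
          AffineYokonuma.HAff.T (AffineYokonuma.YWeyl.ofExt w)) := by
  have : NeZero r := ⟨by omega⟩
  have : NeZero n := ⟨by omega⟩
  refine ⟨?_, ?_, ?_⟩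
  · intro w β k l h
    obtain ⟨rfl, hl⟩ := AffineYokonuma.HAff.isReducedExpr_iff.1 h
    rw [AffineYokonuma.HAff.T_tPow_mul_ofExt hn, AffineYokonuma.HAff.ofExpr_eq hn β k hl]
  · refine ⟨(AffineYokonuma.HAff.pairBasis r hn).reindex
      (Equiv.ofBijective _ (AffineYokonuma.YWeyl.tPow_mul_ofExt_bijective hr hn)), fun w => ?_⟩
    obtain ⟨β, v, rfl⟩ := AffineYokonuma.YWeyl.exists_eq_tPow_mul_ofExt hr hn w
    rw [AffineYokonuma.HAff.T_tPow_mul_ofExt hn, ← AffineYokonuma.HAff.pairBasis_apply hn,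
      Module.Basis.reindex_apply]
    congr 1
    exact (Equiv.ofBijective _
      (AffineYokonuma.YWeyl.tPow_mul_ofExt_bijective hr hn)).symm_apply_apply (β, v)
  · refine ⟨AffineYokonuma.HAff.pairBasis r hn, fun β w => ?_⟩
    rw [AffineYokonuma.HAff.pairBasis_apply, AffineYokonuma.HAff.T_ofExt hn]
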